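/- Let $F=\mathbb F_q$ be a finite field with $q$ elements, $\psi$ a non-trivial additive character of $F$ with values in $\mathbb C^\times$, and $\omega$ a generator of the group of multiplicative characters $F^\times\to\mathbb C^\times$; characters $\omega^k$, including the trivial one, are extended by $\omega^k(0)=0$. Put $g(k)=\sum_{x\in F^\times}\omega^k(x)\psi(x)$ for $k\in\mathbb Z$. Let $\boldsymbol\alpha=(\alpha_1,\dots,\alpha_d)$ and $\boldsymbol\beta=(\beta_1,\dots,\beta_d)$ be rational numbers with $\alpha_i\not\equiv\beta_j \pmod{\mathbb Z}$ for all $i,j$, and suppose that $q$ is coprime to the denominators of all $\alpha_i,\beta_j$. Suppose that the parameters are defined over $\mathbb Q$, with exponents $p_1,\dots,p_r,q_1,\dots,q_s$, i.e. these are positive integers with $\gcd(p_1,\dots,p_r,q_1,\dots,q_s)=1$ and $$\prod_{j=1}^d\frac{X-e^{2\pi i\alpha_j}}{X-e^{2\pi i\beta_j}}=\frac{\prod_{i=1}^r(X^{p_i}-1)}{\prod_{j=1}^s(X^{q_j}-1)}.$$ Let $D(X)$ be the greatest common divisor of $\prod_i(X^{p_i}-1)$ and $\prod_j(X^{q_j}-1)$,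 let $s(m)$ be the multiplicity of $e^{2\pi i m/(q-1)}$ as a zero of $D(X)$, and put $M=\prod_i p_i^{p_i}\prod_j q_j^{-q_j}$, $\epsilon=(-1)^{\sum_j q_j}$. For $t\in F$ define $$H_q(\boldsymbol\alpha,\boldsymbol\beta|t)=\frac{(-1)^{r+s}}{1-q}\sum_{m=0}^{q-2}q^{-s(0)+s(m)}\prod_{i=1}^r g(p_im)\prod_{j=1}^s g(-q_jm)\ \omega^m(\epsilon M^{-1}t).$$ With $\{y\}$ denoting the fractional part of $y$, put $\Lambda(x)=\sum_{i=1}^r\{p_ix\}+\sum_{j=1}^s\{-q_jx\}$. Then the minimum $\lambda=\min_{0<x<1}\Lambda(x)$ exists and is an integer, $\lambda\ge 1$, and $$q^{\min(r,s)-\lambda}H_q(\boldsymbol\alpha,\boldsymbol\beta|t)\in\mathbb Z\qquad\text{for all }t\in F.$$ The same three assertions hold when $\lambda$ is replaced by the minimum of $\Lambda$ over those $x\in[0,1]$ for which none of the numbers $p_ix$, $q_jx$ is an integer. -/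

import Mathlib

open Polynomial

namespace FiniteHypergeometric

noncomputable section

/-- The root of unity `e^{2πi x}`. -/
def expRoot (x : ℚ) : ℂ := Complex.exp (2 * Real.pi * Complex.I * (x : ℂ))

/-- `e` and `f` are exponents for the parameters `α`, `β`: all exponents are positive, their overall
gcd is one, and
`∏ (X - e^{2πi α_j}) / ∏ (X - e^{2πi β_j}) = ∏ (X ^ e_i - 1) / ∏ (X ^ f_j - 1)`
(written without denominators). -/
structure IsGammaVector {d r s : ℕ} (α β : Fin d → ℚ) (e : Fin r → ℕ) (f : Fin s → ℕ) : Prop where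
  pos_left : ∀ i, 0 < e i
  pos_right : ∀ j, 0 < f j
  gcd_eq_one : Nat.gcd (Finset.univ.gcd e) (Finset.univ.gcd f) = 1
  cross_mul : (∏ j, (X - C (expRoot (α j)) : ℂ[X])) * ∏ j, (X ^ f j - 1 : ℂ[X]) =
    (∏ j, (X - C (expRoot (β j)) : ℂ[X])) * ∏ i, (X ^ e i - 1 : ℂ[X])

open Classical in
/-- The greatest common divisor `D(X)` of `∏ (X ^ e_i - 1)` and `∏ (X ^ f_j - 1)`, which is
determined up to a nonzero constant factor. -/
def gcdPoly {r s : ℕ} (e : Fin r → ℕ) (f : Fin s → ℕ) : ℂ[X] :=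
  EuclideanDomain.gcd (∏ i, (X ^ e i - 1 : ℂ[X])) (∏ j, (X ^ f j - 1 : ℂ[X]))

/-- `s(m)`: the multiplicity of the zero `e^{2πi m / (q - 1)}` in `D(X)`. -/
def zeroMult {r s : ℕ} (e : Fin r → ℕ) (f : Fin s → ℕ) (q m : ℕ) : ℕ :=
  (gcdPoly e f).rootMultiplicity (expRoot ((m : ℚ) / ((q : ℚ) - 1)))

/-- `M = ∏ e_i ^ e_i * ∏ f_j ^ (-f_j)`. -/
def bigM {r s : ℕ} (e : Fin r → ℕ) (f : Fin s → ℕ) : ℚ :=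
  (∏ i, (e i : ℚ) ^ e i) / ∏ j, (f j : ℚ) ^ f j

/-- The finite hypergeometric sum over `ℚ`
`H_q = (-1)^(r+s) / (1 - q) * ∑_{m=0}^{q-2} q^(-s(0)+s(m)) * ∏ g(e_i m) * ∏ g(-f_j m) * ω(ε M⁻¹ t)^m`
with `g(k) = ∑_x ω^k(x) ψ(x)` and `ε = (-1)^(∑ f_j)`. The multiplicative characters `ω^m`
vanish at `0` (for `m = 0` as well), so that the value at `t = 0` is `0`. -/
def hypergeometricSum {F : Type*} [Field F] [Fintype F] (ψ : AddChar F ℂ) (ω : MulChar F ℂ)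
    {r s : ℕ} (e : Fin r → ℕ) (f : Fin s → ℕ) (t : F) : ℂ :=
  (-1) ^ (r + s) / (1 - (Fintype.card F : ℂ)) *
    ∑ m ∈ Finset.range (Fintype.card F - 1),
      (Fintype.card F : ℂ) ^
          (-(zeroMult e f (Fintype.card F) 0 : ℤ) + (zeroMult e f (Fintype.card F) m : ℤ)) *
        (∏ i, gaussSum (ω ^ ((e i : ℤ) * m)) ψ) *
        (∏ j, gaussSum (ω ^ (-(f j : ℤ) * m)) ψ) *
        (ω ^ m) ((-1) ^ (∑ j, f j) * ((bigM e f : ℚ) : F)⁻¹ * t)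

/-- `{e_1 x} + ⋯ + {e_r x} + {-f_1 x} + ⋯ + {-f_s x}`. -/
def landau {r s : ℕ} (e : Fin r → ℕ) (f : Fin s → ℕ) (x : ℝ) : ℝ :=
  (∑ i, Int.fract ((e i : ℝ) * x)) + ∑ j, Int.fract (-(f j : ℝ) * x)

/-- The points of `[0, 1]` at which none of the numbers `e_i x`, `f_j x` is an integer. -/
def genericPoints {r s : ℕ} (e : Fin r → ℕ) (f : Fin s → ℕ) : Set ℝ :=
  {x | x ∈ Set.Icc (0 : ℝ) 1 ∧ (∀ i, ∀ n : ℤ, (e i : ℝ) * x ≠ n) ∧ ∀ j, ∀ n : ℤ, (f j : ℝ) * x ≠ n}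

end

end FiniteHypergeometric

namespace FiniteHypergeometric

noncomputable section

/-! Opening the Gauss sums turns the sum over `m` into exponential sums over `(Fˣ)^(r+s)` of `ψ (∑
x_i)` weighted by a function of the monomial `∏ x_i ^ c_i`, where `c = (e, -f)`. Comparing degrees
gives `∑ c_i = 0`, so scaling `x` fixes the weight and averages `ψ` to a rational number. With an
integer-valued weight the sum is rational and an algebraic integer, hence an integer
(`expSum_mem_intRange`). Since `s(m)` depends only on `gcd(m, q-1)` and `q ^ s(m) ≡ 1` modulo `q -
1`, the whole sum equals `(q - 1) * k` with `k ∈ ℤ` (`exists_int_weighted_gaussSum`).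

As `s(0) = min(r, s)`, it remains to see that `q ^ λ` divides `k`. Because `k` is an integer, one
valuation of `ℂ` above `p` decides this. Let `q = p ^ n`. Stickelberger's theorem
(`exists_valuation_gaussSum`) gives the term of index `m` the `p`-order `n * s(m) + ∑_l Λ(x_l)`,
with `x_l = m c p^l / (q - 1)`, `0 ≤ l < n`, and `c` prime to `q - 1`.

Just to the left of a point `x`, `Λ` exceeds `Λ(x)` by the number of integers among the `e_i x`;
just to the right, by the number among the `f_j x`. At `x_l` the smaller of these is at most `s(m)`,
so `Λ(x_l) + s(m)` is bounded below by a value of `Λ` at a generic point (`exists_generic_landau`),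
hence by `λ`. Summing over `l` gives order at least `n * λ`. The minima exist and are positive
because `Λ` takes integer values and, the gcd being one, is positive on `(0, 1)`. -/

/-! ### Preliminaries on integers in `ℂ` and on characters. -/

theorem mem_intRange_of_isIntegral {z : ℂ} (hz : IsIntegral ℤ z) {n : ℤ} (hn : n ≠ 0)
    (h : (n : ℂ) * z ∈ (Int.castRingHom ℂ).range) : z ∈ (Int.castRingHom ℂ).range := by
  obtain ⟨m, hm⟩ := h
  have hn' : (n : ℂ) ≠ 0 := by exact_mod_cast hn
  have hz' : z = algebraMap ℚ ℂ ((m : ℚ) / n) := by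
    simp only [eq_intCast] at hm
    rw [map_div₀, map_intCast, map_intCast, eq_div_iff hn', hm, mul_comm]
  rw [hz', isIntegral_algebraMap_iff (algebraMap ℚ ℂ).injective,
    IsIntegrallyClosed.isIntegral_iff] at hz
  obtain ⟨k, hk⟩ := hz
  exact ⟨k, by rw [hz', ← hk]; simp⟩

theorem prod_zpow_eq_zpow_sum {G ι : Type*} [CommGroup G] (s : Finset ι) (a : G) (c : ι → ℤ) :
    ∏ i ∈ s, a ^ c i = a ^ ∑ i ∈ s, c i := by
  classical
  induction s using Finset.induction_on with
  | empty => simp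
  | insert i s hi ih => rw [Finset.prod_insert hi, Finset.sum_insert hi, zpow_add, ih]

theorem map_sum_eq_prod_addChar {A ι : Type*} [AddCommGroup A] (ψ : AddChar A ℂ) (s : Finset ι)
    (x : ι → A) : ψ (∑ i ∈ s, x i) = ∏ i ∈ s, ψ (x i) := by
  classical
  induction s using Finset.induction_on with
  | empty => simp
  | insert i s hi ih =>
    rw [Finset.prod_insert hi, Finset.sum_insert hi, AddChar.map_add_eq_mul, ih]

theorem mulChar_zpow_apply {F : Type*} [Field F] (ω : MulChar F ℂ) (n : ℤ) (a : Fˣ) :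
    (ω ^ n) a = ω ((a ^ n : Fˣ) : F) := by
  cases n with
  | ofNat n => simp [MulChar.pow_apply_coe]
  | negSucc n =>
    rw [zpow_negSucc, zpow_negSucc, MulChar.inv_apply_eq_inv', MulChar.pow_apply_coe]
    have h : ω (((a ^ (n + 1))⁻¹ : Fˣ) : F) * ω ((a ^ (n + 1) : Fˣ) : F) = 1 := by
      rw [← map_mul, ← Units.val_mul, inv_mul_cancel]; simp
    rw [eq_comm, ← inv_inv (ω _), inv_inj]
    rw [← map_pow, ← Units.val_pow_eq_pow_val]
    exact inv_eq_of_mul_eq_one_right h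

/-! ### Exponential sums over `Fˣ`. -/

section Field

variable {F : Type*} [Field F] [Fintype F]

theorem addChar_isIntegral (ψ : AddChar F ℂ) (y : F) : IsIntegral ℤ (ψ y) := by
  refine IsIntegral.of_pow Fintype.card_pos (?_ : IsIntegral ℤ (ψ y ^ Fintype.card F))
  rw [← AddChar.map_nsmul_eq_pow, card_nsmul_eq_zero, AddChar.map_zero_eq_one]
  exact isIntegral_one

theorem mulChar_unit_pow_eq_one (χ : MulChar F ℂ) (u : Fˣ) :
    χ u ^ (Fintype.card F - 1) = 1 := by
  rw [← map_pow, FiniteField.pow_card_sub_one_eq_one _ u.ne_zero]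
  simp

theorem mulChar_isIntegral (χ : MulChar F ℂ) (y : F) : IsIntegral ℤ (χ y) := by
  rcases eq_or_ne y 0 with rfl | hy
  · rw [MulChar.map_zero]; exact isIntegral_zero
  · lift y to Fˣ using hy.isUnit
    refine IsIntegral.of_pow (Nat.sub_pos_of_lt (Fintype.one_lt_card (α := F))) (?_ : IsIntegral ℤ _)
    rw [mulChar_unit_pow_eq_one]
    exact isIntegral_one

variable [DecidableEq F]

theorem sum_units_addChar_mul {ψ : AddChar F ℂ} (hψ : ψ ≠ 1) (y : F) :
    ∑ a : Fˣ, ψ (a * y) = if y = 0 then (Fintype.card F : ℂ) - 1 else -1 := by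
  have h1 : ∑ a : F, ψ (a * y) = if y = 0 then (Fintype.card F : ℂ) else 0 := by
    rw [AddChar.sum_mulShift y (AddChar.IsPrimitive.of_ne_one hψ)]
    split_ifs <;> simp
  have h2 : ∑ a : F, (if a = 0 then 0 else ψ (a * y)) = ∑ a : Fˣ, ψ (a * y) := by
    symm
    refine Fintype.sum_of_injective (fun a : Fˣ => (a : F)) Units.val_injective _ _ ?_ ?_
    · intro i hi
      rw [if_pos]
      by_contra h
      exact hi ⟨Units.mk0 i h, rfl⟩
    · intro i; simp
  have h3 : ∑ a : F, ψ (a * y) = 1 + ∑ a : F, (if a = 0 then 0 else ψ (a * y)) := by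
    have : ∀ a : F, ψ (a * y) = (if a = 0 then 1 else 0) + (if a = 0 then 0 else ψ (a * y)) := by
      intro a; split_ifs with h <;> simp [h]
    conv_lhs => rw [Finset.sum_congr rfl fun a _ => this a]
    rw [Finset.sum_add_distrib]
    simp
  rw [← h2]
  split_ifs with h <;> simp only [h, if_true, if_false] at h1 h3 ⊢ <;> linear_combination h1 - h3

/-- An exponential sum weighted by a function of a monomial of degree zero is an integer. -/
theorem expSum_mem_intRange {ι : Type*} [Fintype ι] [DecidableEq ι] {ψ : AddChar F ℂ} (hψ : ψ ≠ 1)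
    (c : ι → ℤ) (hc : ∑ i, c i = 0) (K : Fˣ → ℤ) :
    ∑ x : ι → Fˣ, (K (∏ i, x i ^ c i) : ℂ) * ψ (∑ i, (x i : F)) ∈ (Int.castRingHom ℂ).range := by
  have hq : ((Fintype.card F : ℤ) - 1) ≠ 0 := by
    have := Fintype.one_lt_card (α := F); omega
  refine mem_intRange_of_isIntegral ?_ hq ?_
  · refine IsIntegral.sum _ fun x _ => IsIntegral.mul ?_ (addChar_isIntegral _ _)
    exact isIntegral_algebraMap (R := ℤ) (x := K _)
  -- Substitute `a * x_i` for `x_i`: the monomial picks up the factor `a ^ ∑ c_i = 1`.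
  · have key : ∀ a : Fˣ, ∑ x : ι → Fˣ, (K (∏ i, x i ^ c i) : ℂ) * ψ (∑ i, (x i : F)) =
        ∑ x : ι → Fˣ, (K (∏ i, x i ^ c i) : ℂ) * ψ (a * ∑ i, (x i : F)) := by
      intro a
      symm
      refine Fintype.sum_equiv (Equiv.mulLeft fun _ => a) _ _ fun x => ?_
      have : ∏ i, a ^ c i = 1 := by rw [prod_zpow_eq_zpow_sum, hc, zpow_zero]
      simp [mul_zpow, Finset.prod_mul_distrib, this, Finset.mul_sum]
    have hcard : (((Fintype.card F : ℤ) - 1 : ℤ) : ℂ) = (Fintype.card Fˣ : ℂ) := by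
      rw [Fintype.card_units, Nat.cast_sub Fintype.card_pos]; simp
    have : (((Fintype.card F : ℤ) - 1 : ℤ) : ℂ) *
        ∑ x : ι → Fˣ, (K (∏ i, x i ^ c i) : ℂ) * ψ (∑ i, (x i : F)) =
        ∑ x : ι → Fˣ, (K (∏ i, x i ^ c i) : ℂ) *
          ∑ a : Fˣ, ψ (a * ∑ i, (x i : F)) := by
      rw [hcard, ← nsmul_eq_mul, ← Finset.card_univ, ← Finset.sum_const,
        Finset.sum_congr rfl fun a _ => key a, Finset.sum_comm]
      simp_rw [Finset.mul_sum]
    rw [this]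
    refine Subring.sum_mem _ fun x _ => Subring.mul_mem _ ⟨_, rfl⟩ ?_
    rw [sum_units_addChar_mul hψ]
    split_ifs
    · exact ⟨(Fintype.card F : ℤ) - 1, by simp⟩
    · exact ⟨-1, by simp⟩

theorem gaussSum_eq_sum_units (χ : MulChar F ℂ) (ψ : AddChar F ℂ) :
    gaussSum χ ψ = ∑ a : Fˣ, χ a * ψ a := by
  symm
  refine Fintype.sum_of_injective (fun a : Fˣ => (a : F)) Units.val_injective _ _ ?_ fun _ => rfl
  intro i hi
  rw [MulChar.map_nonunit, zero_mul]
  exact fun h => hi ⟨h.unit, rfl⟩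

/-- In this form `m` occurs only as the exponent of one root of unity, so that sums over `m` become
geometric series. -/
theorem prod_gaussSum_eq {ι : Type*} [Fintype ι] [DecidableEq ι] (ψ : AddChar F ℂ) (ω : MulChar F ℂ)
    (c : ι → ℤ) (m : ℕ) :
    ∏ i, gaussSum (ω ^ (c i * m)) ψ =
      ∑ x : ι → Fˣ, ω ((∏ i, x i ^ c i : Fˣ) : F) ^ m * ψ (∑ i, (x i : F)) := by
  simp_rw [gaussSum_eq_sum_units]
  rw [Finset.prod_univ_sum]
  simp only [Fintype.piFinset_univ]
  refine Finset.sum_congr rfl fun x _ => ?_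
  rw [Finset.prod_mul_distrib, map_sum_eq_prod_addChar]
  congr 1
  rw [← map_pow, ← Units.val_pow_eq_pow_val, ← Finset.prod_pow, Units.coe_prod, map_prod]
  refine Finset.prod_congr rfl fun i _ => ?_
  rw [mulChar_zpow_apply, zpow_mul, zpow_natCast]

end Field

/-! ### Integrality of sums over `m` weighted by a function of `gcd(m, N)`. -/

theorem sum_filter_dvd_pow {N n : ℕ} (hN : 0 < N) (hn : n ∣ N) {z : ℂ} (hz : z ^ N = 1) :
    ∑ m ∈ Finset.range N with n ∣ m, z ^ m =
      ((if z ^ n = 1 then ((N / n : ℕ) : ℤ) else 0 : ℤ) : ℂ) := by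
  obtain ⟨k, rfl⟩ := hn
  have hn0 : 0 < n := Nat.pos_of_mul_pos_right hN
  have : ∑ m ∈ Finset.range (n * k) with n ∣ m, z ^ m = ∑ j ∈ Finset.range k, (z ^ n) ^ j := by
    symm
    refine Finset.sum_bij (fun j _ => n * j) ?_ ?_ ?_ ?_
    · intro j hj
      simp only [Finset.mem_range, Finset.mem_filter] at hj ⊢
      exact ⟨Nat.mul_lt_mul_of_pos_left hj hn0, dvd_mul_right _ _⟩
    · intro a _ b _ h
      exact Nat.eq_of_mul_eq_mul_left hn0 h
    · intro b hb
      simp only [Finset.mem_range, Finset.mem_filter] at hb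
      obtain ⟨hb, j, rfl⟩ := hb
      exact ⟨j, Finset.mem_range.2 (Nat.lt_of_mul_lt_mul_left hb), rfl⟩
    · intro j _
      rw [pow_mul]
  rw [this, Nat.mul_div_cancel_left _ hn0]
  split_ifs with h
  · simp [h]
  · rw [geom_sum_eq h, ← pow_mul, hz]; simp

/-- If all the sums of `A` over multiples of a divisor of `N` are integers, so are the sums over
the residues having a given gcd with `N`, and hence the sums weighted by an integral function of
the gcd. -/
theorem weighted_sum_mem_intRange {N : ℕ} (hN : 0 < N) (A : ℕ → ℂ)
    (hA : ∀ n, n ∣ N → ∑ m ∈ Finset.range N with n ∣ m, A m ∈ (Int.castRingHom ℂ).range)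
    (h : ℕ → ℤ) (hh : ∀ m < N, h m = h (Nat.gcd m N % N)) :
    ∑ m ∈ Finset.range N, (h m : ℂ) * A m ∈ (Int.castRingHom ℂ).range := by
  have hC : ∀ k d, N - d = k → d ∣ N →
      ∑ m ∈ Finset.range N with Nat.gcd m N = d, A m ∈ (Int.castRingHom ℂ).range := by
    -- Downward induction on `d`: the sum over multiples of `d` splits by gcd into the wanted sum
    -- and those for proper multiples `d'` of `d`.
    intro k
    induction k using Nat.strong_induction_on with
    | _ k ih =>
    intro d hk hd
    have hsplit : ∑ m ∈ Finset.range N with d ∣ m, A m =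
        ∑ d' ∈ N.divisors with d ∣ d', ∑ m ∈ Finset.range N with Nat.gcd m N = d', A m := by
      rw [← Finset.sum_fiberwise_of_maps_to (s := Finset.range N |>.filter (d ∣ ·))
        (t := N.divisors.filter (d ∣ ·)) (g := fun m => Nat.gcd m N)]
      · refine Finset.sum_congr rfl fun d' hd' => Finset.sum_congr ?_ fun _ _ => rfl
        ext m
        simp only [Finset.mem_filter, Finset.mem_range, Nat.mem_divisors] at hd' ⊢
        constructor
        · rintro ⟨⟨h1, _⟩, h3⟩; exact ⟨h1, h3⟩
        · rintro ⟨h1, h3⟩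
          exact ⟨⟨h1, hd'.2.trans (h3 ▸ Nat.gcd_dvd_left _ _)⟩, h3⟩
      · intro m hm
        simp only [Finset.mem_filter, Finset.mem_range, Nat.mem_divisors] at hm ⊢
        exact ⟨⟨Nat.gcd_dvd_right _ _, hN.ne'⟩, Nat.dvd_gcd hm.2 hd⟩
    have hmem : d ∈ N.divisors.filter (d ∣ ·) := by
      simp [hd, hN.ne']
    rw [← Finset.add_sum_erase _ _ hmem] at hsplit
    rw [← sub_eq_iff_eq_add] at hsplit
    rw [← hsplit]
    refine Subring.sub_mem _ (hA d hd) (Subring.sum_mem _ fun d' hd' => ?_)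
    simp only [Finset.mem_erase, Finset.mem_filter, Nat.mem_divisors] at hd'
    have h1 : d' ≤ N := Nat.le_of_dvd hN hd'.2.1.1
    have h2 : 0 < d' := Nat.pos_of_dvd_of_pos hd'.2.1.1 hN
    have h3 : d ≤ d' := Nat.le_of_dvd h2 hd'.2.2
    exact ih (N - d') (by omega) d' rfl hd'.2.1.1
  rw [← Finset.sum_fiberwise_of_maps_to (t := N.divisors) (g := fun m => Nat.gcd m N)
    (fun m _ => by simp [Nat.mem_divisors, Nat.gcd_dvd_right, hN.ne'])]
  refine Subring.sum_mem _ fun d hd => ?_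
  have : ∑ m ∈ Finset.range N with Nat.gcd m N = d, (h m : ℂ) * A m =
      (h (d % N) : ℂ) * ∑ m ∈ Finset.range N with Nat.gcd m N = d, A m := by
    rw [Finset.mul_sum]
    refine Finset.sum_congr rfl fun m hm => ?_
    simp only [Finset.mem_filter, Finset.mem_range] at hm
    rw [hh m hm.1, hm.2]
  rw [this]
  exact Subring.mul_mem _ ⟨_, rfl⟩ (hC _ d rfl (Nat.dvd_of_mem_divisors hd))

/-- The weighted sums of products of Gauss sums are integers divisible by `q - 1`. -/
theorem exists_int_weighted_gaussSum {F : Type*} [Field F] [Fintype F] [DecidableEq F]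
    {ι : Type*} [Fintype ι] [DecidableEq ι] {ψ : AddChar F ℂ} (hψ : ψ ≠ 1) (ω : MulChar F ℂ)
    (c : ι → ℤ) (hc : ∑ i, c i = 0) (σ : ℕ → ℕ)
    (hσ : ∀ m < Fintype.card F - 1,
      σ m = σ (Nat.gcd m (Fintype.card F - 1) % (Fintype.card F - 1))) (u : Fˣ) :
    ∃ k : ℤ, ∑ m ∈ Finset.range (Fintype.card F - 1), (Fintype.card F : ℂ) ^ σ m *
      ((∏ i, gaussSum (ω ^ (c i * m)) ψ) * (ω ^ m) u) = ((Fintype.card F : ℂ) - 1) * k := by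
  set q := Fintype.card F with hqdef
  have hq : 1 < q := Fintype.one_lt_card
  have hN : 0 < q - 1 := by omega
  set A : ℕ → ℂ := fun m => (∏ i, gaussSum (ω ^ (c i * m)) ψ) * (ω ^ m) u with hAdef
  have hA : ∀ n, n ∣ q - 1 → ∑ m ∈ Finset.range (q - 1) with n ∣ m, A m =
      ∑ x : ι → Fˣ, ((if ω (((∏ i, x i ^ c i) * u : Fˣ) : F) ^ n = 1 then
        (((q - 1) / n : ℕ) : ℤ) else 0 : ℤ) : ℂ) * ψ (∑ i, (x i : F)) := by
    intro n hn
    have : ∀ m, A m = ∑ x : ι → Fˣ, ω (((∏ i, x i ^ c i) * u : Fˣ) : F) ^ m *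
        ψ (∑ i, (x i : F)) := by
      intro m
      rw [hAdef]
      simp only []
      rw [prod_gaussSum_eq, MulChar.pow_apply_coe, Finset.sum_mul]
      refine Finset.sum_congr rfl fun x _ => ?_
      rw [Units.val_mul, map_mul, mul_pow]
      ring
    simp_rw [this]
    rw [Finset.sum_comm]
    refine Finset.sum_congr rfl fun x _ => ?_
    rw [← Finset.sum_mul, sum_filter_dvd_pow hN hn (mulChar_unit_pow_eq_one _ _)]
  have hB : ∀ n, n ∣ q - 1 →
      ∑ m ∈ Finset.range (q - 1) with n ∣ m, A m ∈ (Int.castRingHom ℂ).range := by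
    intro n hn
    rw [hA n hn]
    exact expSum_mem_intRange hψ c hc
      fun y => if ω ((y * u : Fˣ) : F) ^ n = 1 then (((q - 1) / n : ℕ) : ℤ) else 0
  -- For `n = 1` orthogonality yields `q - 1` times an indicator, so the unweighted sum is already
  -- divisible by `q - 1`.
  have hB1 : ∃ k : ℤ, ∑ m ∈ Finset.range (q - 1), A m = ((q : ℂ) - 1) * k := by
    obtain ⟨k, hk⟩ := expSum_mem_intRange hψ c hc
      fun y => if ω ((y * u : Fˣ) : F) ^ 1 = 1 then 1 else 0
    refine ⟨k, ?_⟩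
    have h1 := hA 1 (one_dvd _)
    simp only [one_dvd, Finset.filter_true] at h1
    rw [h1]
    simp only [eq_intCast] at hk
    rw [hk, Finset.mul_sum]
    refine Finset.sum_congr rfl fun x _ => ?_
    split_ifs <;> simp [Nat.cast_sub hq.le]
  obtain ⟨k, hk⟩ := hB1
  -- Write `q ^ σ = 1 + (q - 1) * h`; the `1` is covered by `hB1`, and `h` depends only on the gcd.
  choose h hh using fun m : ℕ => sub_one_dvd_pow_sub_one (q : ℤ) m
  obtain ⟨k', hk'⟩ := weighted_sum_mem_intRange hN A hB (fun m => h (σ m)) (fun m hm => by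
    rw [← hσ m hm])
  refine ⟨k + k', ?_⟩
  simp only [eq_intCast] at hk'
  push_cast
  rw [mul_add, ← hk, hk', Finset.mul_sum, ← Finset.sum_add_distrib]
  refine Finset.sum_congr rfl fun m _ => ?_
  have := congrArg (Int.cast : ℤ → ℂ) (hh (σ m))
  push_cast at this
  change _ * A m = _
  linear_combination A m * this

/-! ### Digit sums in base `p`. -/

/-- Multiplication by `p ^ l` modulo `p ^ f - 1` rotates the `f` base-`p` digits: the leading `l`
digits, `k / p ^ (f - l)`, become the lowest ones. -/
theorem fract_pow_mul_div {p f k l : ℕ} (hl : l ≤ f) (hk : k < p ^ f - 1) :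
    Int.fract (((p ^ l * k : ℕ) : ℝ) / ((p ^ f - 1 : ℕ) : ℝ)) =
      ((p ^ l * k : ℕ) : ℝ) / ((p ^ f - 1 : ℕ) : ℝ) - ((k / p ^ (f - l) : ℕ) : ℝ) := by
  obtain ⟨N, hN⟩ : ∃ N, N = p ^ f - 1 := ⟨_, rfl⟩
  rw [← hN] at hk ⊢
  have hN1 : p ^ (f - l) * p ^ l = N + 1 := by rw [← pow_add, Nat.sub_add_cancel hl]; omega
  obtain ⟨P, hP⟩ : ∃ P, P = p ^ l := ⟨_, rfl⟩
  obtain ⟨D, hD⟩ : ∃ D, D = p ^ (f - l) := ⟨_, rfl⟩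
  rw [← hP, ← hD] at hN1 ⊢
  have hD0 : 0 < D := Nat.pos_of_ne_zero (by intro h0; rw [h0] at hN1; omega)
  obtain ⟨h, hh⟩ : ∃ h, h = k / D := ⟨_, rfl⟩
  obtain ⟨m, hm⟩ : ∃ m, m = k % D := ⟨_, rfl⟩
  have hk' : D * h + m = k := by rw [hh, hm]; exact Nat.div_add_mod k D
  have hmD : m < D := by rw [hm]; exact Nat.mod_lt _ hD0
  have hhP : h < P := by
    rw [hh, Nat.div_lt_iff_lt_mul hD0, mul_comm]; omega
  rw [← hh]
  have e1 : P * k = N * h + (h + P * m) := by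
    have : P * k = (D * P) * h + P * m := by rw [← hk']; ring
    rw [this, hN1]; ring
  -- The value `N` would require both `h` and `m` to be maximal, that is `k = N`.
  have e2 : h + P * m < N := by
    by_contra! hcon
    have h1 : P * m + P ≤ N + 1 := by
      rw [← hN1, mul_comm D P, ← Nat.mul_succ]; exact Nat.mul_le_mul_left _ hmD
    have h2 : h + 1 = P := by omega
    have h3 : P * m + P = P * D := by rw [mul_comm P D, hN1]; omega
    have h4 : m + 1 = D := by
      have : P * (m + 1) = P * D := by rw [mul_add, mul_one, h3]
      exact Nat.eq_of_mul_eq_mul_left (by omega) this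
    have : k + 1 = D * P := by rw [← hk', ← h2]; rw [mul_add]; omega
    omega
  have hNpos : (0 : ℝ) < N := by exact_mod_cast (by omega : 0 < N)
  rw [Int.fract_eq_iff]
  have e3 : ((P * k : ℕ) : ℝ) / N - h = ((h + P * m : ℕ) : ℝ) / N := by
    rw [e1]; push_cast; field_simp; ring
  rw [e3]
  refine ⟨by positivity, ?_, h, by rw [← e3]; simp⟩
  rw [div_lt_one hNpos]
  exact_mod_cast e2

/-- The digit sum of `k < p ^ f - 1` in base `p` in terms of fractional parts. -/
theorem sum_fract_eq_sum_digits {p f k : ℕ} (hp : 1 < p) (hf : 0 < f) (hk : k < p ^ f - 1) :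
    ((p : ℝ) - 1) * ∑ l ∈ Finset.range f,
      Int.fract (((p ^ l * k : ℕ) : ℝ) / ((p ^ f - 1 : ℕ) : ℝ)) = ((p.digits k).sum : ℝ) := by
  have hN : (0 : ℝ) < ((p ^ f - 1 : ℕ) : ℝ) := by exact_mod_cast (by omega : 0 < p ^ f - 1)
  rw [Finset.sum_congr rfl fun l hl => fract_pow_mul_div (Finset.mem_range.1 hl).le hk,
    Finset.sum_sub_distrib, ← Finset.sum_div, mul_sub]
  have h1 : ((p : ℝ) - 1) * ((∑ l ∈ Finset.range f, ((p ^ l * k : ℕ) : ℝ)) /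
      ((p ^ f - 1 : ℕ) : ℝ)) = k := by
    have := geom_sum_mul (p : ℝ) f
    push_cast
    rw [← Finset.sum_mul, Nat.cast_sub (Nat.one_le_pow _ _ (by omega))] at *
    push_cast at *
    field_simp
    linear_combination (k : ℝ) * this
  have h2 : ∑ l ∈ Finset.range f, k / p ^ (f - l) = ∑ i ∈ Finset.range f, k / p ^ (i + 1) := by
    rw [← Finset.sum_range_reflect]
    refine Finset.sum_congr rfl fun l hl => ?_
    have := Finset.mem_range.1 hl
    congr 2; omega
  have h3 : ∑ i ∈ Finset.range (Nat.log p k).succ, k / p ^ (i + 1) =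
      ∑ i ∈ Finset.range f, k / p ^ (i + 1) := by
    have hlog : Nat.log p k < f := by
      rcases Nat.eq_zero_or_pos k with rfl | hk0
      · simpa using hf
      · exact (Nat.log_lt_iff_lt_pow hp hk0.ne').2 (by omega)
    refine Finset.sum_subset (Finset.range_subset_range.2 hlog) fun i _ hi => ?_
    simp only [Finset.mem_range, not_lt] at hi
    exact Nat.div_eq_of_lt (Nat.lt_pow_of_log_lt hp (by omega))
  -- Legendre's formula: `(p - 1) * ∑ ⌊k / p^i⌋` is `k` minus its digit sum.
  have h4 := Nat.sub_one_mul_sum_log_div_pow_eq_sub_sum_digits (p := p) k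
  rw [h3, ← h2] at h4
  have h5 : ((p : ℝ) - 1) * ∑ l ∈ Finset.range f, ((k / p ^ (f - l) : ℕ) : ℝ) =
      k - ((p.digits k).sum : ℝ) := by
    rw [← Nat.cast_sub (Nat.digit_sum_le p k), ← h4]
    push_cast [Nat.cast_sub hp.le]
    rfl
  rw [h1, h5]
  ring

/-! ### A valuation of `ℂ` above `p`. -/

section Valuation

variable (V : ValuationSubring ℂ)

/-- Chevalley's extension theorem applied to the proper ideal `(p)` of `ℤ ⊆ ℂ`. Working in `ℂ`
spares the choice of a number field and a prime above `p`. -/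
theorem exists_valuationSubring {p : ℕ} (hp : p.Prime) :
    ∃ V : ValuationSubring ℂ, V.valuation (p : ℂ) < 1 := by
  let I : Ideal ((Int.castRingHom ℂ).range) := Ideal.span {(p : (Int.castRingHom ℂ).range)}
  have hI : I ≠ ⊤ := by
    rw [Ne, Ideal.span_singleton_eq_top]
    intro h
    obtain ⟨⟨_, n, rfl⟩, hn⟩ := h.exists_right_inv
    have h2 : ((p * n : ℤ) : ℂ) = ((1 : ℤ) : ℂ) := by
      simpa using congrArg Subtype.val hn
    have h3 : (p : ℤ) * n = 1 := by exact_mod_cast h2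
    have := Int.isUnit_iff.1 (IsUnit.of_mul_eq_one n h3)
    have := hp.two_le
    omega
  obtain ⟨V, -, hV⟩ := Ideal.image_subset_nonunits_valuationSubring I hI
  refine ⟨V, ?_⟩
  rw [← ValuationSubring.mem_nonunits_iff]
  exact hV ⟨_, Ideal.mem_span_singleton_self _, by simp⟩

theorem mem_of_isIntegral {z : ℂ} (hz : IsIntegral ℤ z) : z ∈ V := by
  have : IsIntegral V z := hz.tower_top
  obtain ⟨y, rfl⟩ := IsIntegrallyClosed.isIntegral_iff.1 this
  exact y.2

theorem valuation_le_one_of_isIntegral {z : ℂ} (hz : IsIntegral ℤ z) : V.valuation z ≤ 1 :=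
  (V.valuation_le_one_iff z).2 (mem_of_isIntegral V hz)

theorem valuation_int_le_one (n : ℤ) : V.valuation (n : ℂ) ≤ 1 :=
  valuation_le_one_of_isIntegral V (isIntegral_algebraMap (R := ℤ) (x := n))

variable {V}

theorem valuation_int_of_isCoprime {p : ℕ} (hpV : V.valuation (p : ℂ) < 1) {n : ℤ} (hn : IsCoprime n p) : V.valuation (n : ℂ) = 1 := by
  refine le_antisymm (valuation_int_le_one V n) ?_
  by_contra! h
  obtain ⟨a, b, hab⟩ := hn
  have h1 : V.valuation ((a : ℂ) * n + b * p) = 1 := by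
    have : ((a * n + b * p : ℤ) : ℂ) = 1 := by rw [hab]; simp
    push_cast at this
    rw [this, map_one]
  have h2 : V.valuation ((a : ℂ) * n + b * p) < 1 := by
    refine Valuation.map_add_lt _ ?_ ?_ <;> rw [map_mul]
    · exact mul_lt_one_of_nonneg_of_lt_one_right (valuation_int_le_one V a) zero_le h
    · exact mul_lt_one_of_nonneg_of_lt_one_right (valuation_int_le_one V b) zero_le hpV
  exact h2.ne h1

/-- Integers prime to `p` have valuation one, so on `ℤ` the valuation only counts factors of `p`. -/
theorem pow_dvd_of_valuation_le {p : ℕ} (hpV : V.valuation (p : ℂ) < 1) (hp : p.Prime) {n : ℤ} {k : ℕ}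
    (h : V.valuation (n : ℂ) ≤ V.valuation (p : ℂ) ^ k) : (p : ℤ) ^ k ∣ n := by
  induction k generalizing n with
  | zero => simp
  | succ k ih =>
    by_cases hpn : (p : ℤ) ∣ n
    · obtain ⟨m, rfl⟩ := hpn
      rw [pow_succ', mul_dvd_mul_iff_left (by exact_mod_cast hp.ne_zero)]
      apply ih
      push_cast at h
      rw [map_mul, pow_succ'] at h
      refine le_of_mul_le_mul_left h ?_
      rw [zero_lt_iff, Valuation.ne_zero_iff]
      exact_mod_cast hp.ne_zero
    · have hc : IsCoprime n p :=
        ((Nat.prime_iff_prime_int.1 hp).irreducible.coprime_iff_not_dvd.2 hpn).symm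
      rw [valuation_int_of_isCoprime hpV hc] at h
      exact absurd h (not_le.2 (pow_lt_one₀ zero_le hpV (Nat.succ_ne_zero k)))

end Valuation

theorem primitiveRoot_isIntegral {n : ℕ} (hn : 0 < n) {ζ : ℂ} (hζ : ζ ^ n = 1) :
    IsIntegral ℤ ζ :=
  IsIntegral.of_pow hn (hζ ▸ isIntegral_one)

theorem valuation_one_sub_pow_le (V : ValuationSubring ℂ) {n : ℕ} (hn : 0 < n) {ζ : ℂ}
    (hζ : ζ ^ n = 1) (i : ℕ) : V.valuation (ζ ^ i - 1) ≤ V.valuation (ζ - 1) := by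
  rw [← geom_sum_mul, map_mul]
  refine mul_le_of_le_one_left' (valuation_le_one_of_isIntegral V ?_)
  exact IsIntegral.sum _ fun j _ => (primitiveRoot_isIntegral hn hζ).pow j

/-- `p` has the same valuation as `(ζ - 1) ^ (p - 1)`. -/
theorem valuation_primitiveRoot_sub_one_pow (V : ValuationSubring ℂ) {p : ℕ} [hp : Fact p.Prime]
    {ζ : ℂ} (hζ : IsPrimitiveRoot ζ p) :
    V.valuation (p : ℂ) = V.valuation (ζ - 1) ^ (p - 1) := by
  have hp0 : 0 < p := hp.out.pos
  have : NeZero p := ⟨hp0.ne'⟩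
  have hle : ∀ ζ μ : ℂ, IsPrimitiveRoot ζ p → IsPrimitiveRoot μ p →
      V.valuation (μ - 1) ≤ V.valuation (ζ - 1) := by
    intro ζ μ hζ hμ
    obtain ⟨i, -, rfl⟩ := hζ.eq_pow_of_pow_eq_one hμ.pow_eq_one
    exact valuation_one_sub_pow_le V hp0 hζ.pow_eq_one i
  -- `p = Φ_p(1) = ∏ (1 - μ)` over the primitive roots `μ`, and all factors have the same valuation.
  rw [← Polynomial.eval_one_cyclotomic_prime, cyclotomic_eq_prod_X_sub_primitiveRoots hζ,
    eval_prod, map_prod]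
  have : ∀ μ ∈ primitiveRoots p ℂ, V.valuation (eval 1 (X - C μ)) = V.valuation (ζ - 1) := by
    intro μ hμ
    have hμ' := (mem_primitiveRoots hp0).1 hμ
    rw [eval_sub, eval_X, eval_C, Valuation.map_sub_swap]
    exact le_antisymm (hle _ _ hζ hμ') (hle _ _ hμ' hζ)
  rw [Finset.prod_congr rfl this, Finset.prod_const, hζ.card_primitiveRoots,
    Nat.totient_prime hp.out]

theorem residue_natCast_prime {p : ℕ} {V : ValuationSubring ℂ} (hpV : V.valuation (p : ℂ) < 1) :
    (p : IsLocalRing.ResidueField V) = 0 := by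
  rw [← map_natCast (IsLocalRing.residue V), IsLocalRing.residue_eq_zero_iff,
    ValuationSubring.valuation_lt_one_iff]
  simpa using hpV

theorem residue_card {F : Type*} [Field F] [Fintype F] {p : ℕ} [CharP F p]
    {V : ValuationSubring ℂ} (hpV : V.valuation (p : ℂ) < 1) :
    (Fintype.card F : IsLocalRing.ResidueField V) = 0 := by
  obtain ⟨n, -, hn⟩ := FiniteField.card F p
  rw [hn, Nat.cast_pow, residue_natCast_prime hpV, zero_pow n.pos.ne']

/-! ### The inverse Teichmüller character. -/

section Teichmuller

variable {F : Type*} [Field F] [Fintype F] {p : ℕ} [hp : Fact p.Prime] [CharP F p]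
  {V : ValuationSubring ℂ}

/-- There are a field embedding `j` of `F` into the residue field and a multiplicative character
`χ`, generating the character group, that lifts `u ↦ j u⁻¹`. -/
theorem exists_teichmuller [DecidableEq F] (hpV : V.valuation (p : ℂ) < 1) {ω : MulChar F ℂ}
    (hω : ∀ χ : MulChar F ℂ, χ ∈ Subgroup.zpowers ω) :
    ∃ (j : F →+* IsLocalRing.ResidueField V) (χ : MulChar F ℂ) (c : ℤ),
      IsCoprime c ((Fintype.card F : ℤ) - 1) ∧ ω = χ ^ c ∧
      orderOf χ = Fintype.card F - 1 ∧
      ∀ (u : Fˣ) (z : V), (z : ℂ) = χ u → IsLocalRing.residue V z = j ((u⁻¹ : Fˣ) : F) := by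
  set N := Fintype.card F - 1 with hN
  have hq : 1 < Fintype.card F := Fintype.one_lt_card
  have hN0 : 0 < N := by omega
  have : NeZero N := ⟨hN0.ne'⟩
  have hcharP : CharP (IsLocalRing.ResidueField V) p :=
    (CharP.charP_iff_prime_eq_zero hp.out).2 (residue_natCast_prime hpV)
  have hNκ : NeZero (N : IsLocalRing.ResidueField V) := ⟨by
    rw [hN, Nat.cast_sub hq.le, residue_card hpV]; simp⟩
  obtain ⟨ζ, hζ⟩ : ∃ ζ : ℂ, IsPrimitiveRoot ζ N := ⟨_, Complex.isPrimitiveRoot_exp N hN0.ne'⟩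
  let ζV : V := ⟨ζ, mem_of_isIntegral V (primitiveRoot_isIntegral hN0 hζ.pow_eq_one)⟩
  have hζV : IsPrimitiveRoot ζV N :=
    IsPrimitiveRoot.of_map_of_injective (f := V.subtype) (by exact hζ) V.subtype_injective
  -- Primitivity survives reduction because `N = q - 1` becomes `-1 ≠ 0` in the residue field.
  have hζκ : IsPrimitiveRoot (IsLocalRing.residue V ζV) N := by
    rw [← isRoot_cyclotomic_iff, ← map_cyclotomic N (IsLocalRing.residue V)]
    exact (hζV.isRoot_cyclotomic hN0).map
  let _ : Algebra (ZMod p) F := ZMod.algebra F p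
  let _ : Algebra (ZMod p) (IsLocalRing.ResidueField V) := ZMod.algebra _ p
  have hsplit : ((X ^ Fintype.card F - X : (ZMod p)[X]).map
      (algebraMap (ZMod p) (IsLocalRing.ResidueField V))).Splits := by
    have : (X ^ Fintype.card F - X : (ZMod p)[X]).map
        (algebraMap (ZMod p) (IsLocalRing.ResidueField V)) = X * (X ^ N - C 1) := by
      rw [Polynomial.map_sub, Polynomial.map_pow, map_X, mul_sub, ← pow_succ', hN,
        Nat.sub_add_cancel hq.le]
      simp
    rw [this]
    exact Splits.X.mul (X_pow_sub_one_splits hζκ)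
  let j : F →+* IsLocalRing.ResidueField V :=
    (IsSplittingField.lift F (X ^ Fintype.card F - X : (ZMod p)[X]) hsplit).toRingHom
  obtain ⟨g, hg⟩ := IsCyclic.exists_generator (α := Fˣ)
  have hgN : (j ((g⁻¹ : Fˣ) : F)) ^ N = 1 := by
    rw [← map_pow, FiniteField.pow_card_sub_one_eq_one _ (Units.ne_zero _), map_one]
  -- `ζ ^ k` is the root of unity lifting `j g⁻¹`; it serves as the value of `χ` at the generator
  -- `g`.
  obtain ⟨k, -, hk⟩ := hζκ.eq_pow_of_pow_eq_one hgN
  let ξ : ℂˣ := Units.mk0 (ζ ^ k) (pow_ne_zero _ (hζ.ne_zero hN0.ne'))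
  have hξ : ξ ∈ rootsOfUnity (Fintype.card Fˣ) ℂ := by
    rw [mem_rootsOfUnity, Fintype.card_units, Units.ext_iff]
    simp only [ξ, Units.val_pow_eq_pow_val, Units.val_mk0, Units.val_one]
    rw [← pow_mul, mul_comm, pow_mul, hζ.pow_eq_one, one_pow]
  let χ : MulChar F ℂ := MulChar.ofRootOfUnity hξ hg
  have hχg : χ g = ζ ^ k := MulChar.ofRootOfUnity_spec hξ hg
  have hres : ∀ (u : Fˣ) (z : V), (z : ℂ) = χ u →
      IsLocalRing.residue V z = j ((u⁻¹ : Fˣ) : F) := by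
    intro u z hz
    obtain ⟨n, rfl⟩ := (Submonoid.mem_powers_iff _ _).1 (mem_powers_iff_mem_zpowers.2 (hg u))
    have : z = (ζV ^ k) ^ n := by
      apply Subtype.ext
      rw [hz, Units.val_pow_eq_pow_val, map_pow, hχg]
      rfl
    rw [this, map_pow, map_pow, hk, ← map_pow, ← Units.val_pow_eq_pow_val, inv_pow]
  have hpow : ∀ η : MulChar F ℂ, η ^ N = 1 := by
    intro η
    ext u
    rw [MulChar.pow_apply_coe, mulChar_unit_pow_eq_one, MulChar.one_apply_coe]
  have hord : ∀ n : ℕ, χ ^ n = 1 → N ∣ n := by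
    intro n hn
    have h1 : (ζ ^ k) ^ n = 1 := by
      rw [← hχg, ← MulChar.pow_apply_coe, hn, MulChar.one_apply_coe]
    have h2 : (ζV ^ k) ^ n = 1 := Subtype.ext h1
    have h3 := congrArg (IsLocalRing.residue V) h2
    rw [map_pow, map_pow, hk, ← map_pow, map_one, ← map_one j] at h3
    have h4 : (g⁻¹) ^ n = 1 := by
      apply Units.ext
      simpa using j.injective h3
    rw [inv_pow, inv_eq_one] at h4
    rw [hN, ← Fintype.card_units, ← Nat.card_eq_fintype_card,
      ← orderOf_eq_card_of_forall_mem_zpowers hg]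
    exact orderOf_dvd_of_pow_eq_one h4
  have hordχ : orderOf χ = N :=
    Nat.dvd_antisymm (orderOf_dvd_of_pow_eq_one (hpow χ)) (hord _ (pow_orderOf_eq_one χ))
  obtain ⟨a, ha⟩ := hω χ
  have hfin : Finite (Subgroup.zpowers ω) := by
    refine Set.Finite.to_subtype (finite_zpowers.2 ?_)
    exact isOfFinOrder_iff_pow_eq_one.2 ⟨N, hN0, hpow ω⟩
  have hzp : Subgroup.zpowers χ = Subgroup.zpowers ω := by
    refine Subgroup.eq_of_le_of_card_ge (Subgroup.zpowers_le.2 (hω χ)) ?_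
    rw [Nat.card_zpowers, Nat.card_zpowers, hordχ]
    exact Nat.le_of_dvd hN0 (orderOf_dvd_of_pow_eq_one (hpow ω))
  obtain ⟨c, hc⟩ : ω ∈ Subgroup.zpowers χ := hzp ▸ Subgroup.mem_zpowers ω
  simp only at ha hc
  refine ⟨j, χ, c, ?_, hc.symm, hordχ, hres⟩
  have h1 : χ ^ (c * a - 1) = 1 := by
    rw [zpow_sub, zpow_mul, hc, ha, zpow_one, mul_inv_cancel]
  have h2 : (N : ℤ) ∣ c * a - 1 := by
    rw [← hordχ]; exact orderOf_dvd_iff_zpow_eq_one.2 h1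
  obtain ⟨b, hb⟩ := h2
  refine ⟨a, -b, ?_⟩
  have : (N : ℤ) = (Fintype.card F : ℤ) - 1 := by omega
  rw [← this]
  linear_combination hb

end Teichmuller

/-! ### The trace character and its shifts. -/

section TraceChar

variable (F : Type*) [Field F] {p : ℕ} [hp : Fact p.Prime] [Algebra (ZMod p) F]

/-- The additive character `x ↦ ζ ^ Tr(x)`. -/
def traceChar {ζ : ℂ} (hζ : IsPrimitiveRoot ζ p) : AddChar F ℂ :=
  (AddChar.zmodChar p hζ.pow_eq_one).compAddMonoidHom (Algebra.trace (ZMod p) F).toAddMonoidHom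

theorem traceChar_apply {ζ : ℂ} (hζ : IsPrimitiveRoot ζ p) (x : F) :
    traceChar F hζ x = ζ ^ (Algebra.trace (ZMod p) F x).val :=
  rfl

variable [Fintype F]

theorem traceChar_pow {ζ : ℂ} (hζ : IsPrimitiveRoot ζ p) (x : F) :
    traceChar F hζ (x ^ p) = traceChar F hζ x := by
  rw [traceChar_apply, traceChar_apply]
  have := Algebra.trace_eq_of_algEquiv
    (FiniteField.frobeniusAlgEquivOfAlgebraic (ZMod p) F) x
  rw [FiniteField.coe_frobeniusAlgEquivOfAlgebraic, ZMod.card] at this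
  rw [this]

theorem traceChar_ne_one {ζ : ℂ} (hζ : IsPrimitiveRoot ζ p) : traceChar F hζ ≠ 1 := by
  obtain ⟨x, hx⟩ := Algebra.trace_surjective (ZMod p) F 1
  rw [AddChar.ne_one_iff]
  refine ⟨x, ?_⟩
  have : Fact (1 < p) := ⟨hp.out.one_lt⟩
  rw [traceChar_apply, hx, ZMod.val_one, pow_one]
  exact hζ.ne_one hp.out.one_lt

/-- The shifts of `ψ₀` are distinct and as numerous as the characters of `F`. -/
theorem exists_eq_mulShift {F : Type*} [Field F] [Fintype F] {ψ ψ₀ : AddChar F ℂ} (hψ : ψ ≠ 1)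
    (hψ₀ : ψ₀ ≠ 1) : ∃ a : Fˣ, ψ = ψ₀.mulShift a := by
  have hinj := AddChar.to_mulShift_inj_of_isPrimitive (AddChar.IsPrimitive.of_ne_one hψ₀)
  have hbij := (Fintype.bijective_iff_injective_and_card ψ₀.mulShift).2
    ⟨hinj, AddChar.card_eq.symm⟩
  obtain ⟨a, rfl⟩ := hbij.2 ψ
  have ha : a ≠ 0 := by
    rintro rfl
    exact hψ (by rw [AddChar.mulShift_zero])
  exact ⟨Units.mk0 a ha, rfl⟩

end TraceChar

/-! ### Stickelberger's theorem. -/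

section Stickelberger

variable {F : Type*} [Field F] [Fintype F] {p : ℕ} [hp : Fact p.Prime]
  {V : ValuationSubring ℂ}

theorem gaussSum_isIntegral (χ : MulChar F ℂ) (ψ : AddChar F ℂ) : IsIntegral ℤ (gaussSum χ ψ) :=
  IsIntegral.sum _ fun x _ => (mulChar_isIntegral χ x).mul (addChar_isIntegral ψ x)

theorem valuation_mulChar_unit (V : ValuationSubring ℂ) (χ : MulChar F ℂ) (u : Fˣ) :
    V.valuation (χ u) = 1 := by
  have h := congrArg V.valuation (mulChar_unit_pow_eq_one χ u)
  rw [map_pow, map_one] at h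
  refine le_antisymm (valuation_le_one_of_isIntegral V (mulChar_isIntegral χ u)) ?_
  by_contra! hlt
  exact (pow_lt_one₀ zero_le hlt (Nat.sub_ne_zero_of_lt (Fintype.one_lt_card (α := F)))).ne h

theorem valuation_gaussSum_mulShift (V : ValuationSubring ℂ) (χ : MulChar F ℂ) (ψ : AddChar F ℂ)
    (a : Fˣ) : V.valuation (gaussSum χ (ψ.mulShift a)) = V.valuation (gaussSum χ ψ) := by
  rw [← gaussSum_mulShift χ ψ a, map_mul, valuation_mulChar_unit, one_mul]

theorem valuation_gaussSum_one (V : ValuationSubring ℂ) {ψ : AddChar F ℂ} (hψ : ψ ≠ 1) :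
    V.valuation (gaussSum 1 ψ) = 1 := by
  rw [gaussSum_one_left hψ, Valuation.map_neg, map_one]

theorem valuation_gaussSum_mul_inv (V : ValuationSubring ℂ) {χ : MulChar F ℂ} (hχ : χ ≠ 1)
    {ψ : AddChar F ℂ} (hψ : ψ ≠ 1) :
    V.valuation (gaussSum χ ψ) * V.valuation (gaussSum χ⁻¹ ψ) =
      V.valuation (Fintype.card F : ℂ) := by
  rw [← gaussSum_mul_gaussSum_eq_card hχ (AddChar.IsPrimitive.of_ne_one hψ), map_mul,
    ψ.inv_mulShift, ← Units.coe_neg_one, valuation_gaussSum_mulShift]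

/-- For `χ * φ ≠ 1` the quotient of the two sides is the valuation of a Jacobi sum, an algebraic
integer. -/
theorem valuation_gaussSum_mul_le (V : ValuationSubring ℂ) (χ φ : MulChar F ℂ)
    {ψ : AddChar F ℂ} (hψ : ψ ≠ 1) :
    V.valuation (gaussSum χ ψ) * V.valuation (gaussSum φ ψ) ≤
      V.valuation (gaussSum (χ * φ) ψ) := by
  by_cases h : χ * φ = 1
  · rw [h, valuation_gaussSum_one V hψ, ← map_mul]
    exact valuation_le_one_of_isIntegral V
      ((gaussSum_isIntegral χ ψ).mul (gaussSum_isIntegral φ ψ))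
  · rw [← map_mul, ← jacobiSum_mul_nontrivial h ψ, map_mul]
    refine mul_le_of_le_one_right' (valuation_le_one_of_isIntegral V ?_)
    exact IsIntegral.sum _ fun x _ => (mulChar_isIntegral χ _).mul (mulChar_isIntegral φ _)

theorem gaussSum_pow_prime [CharP F p] (χ : MulChar F ℂ) {ψ : AddChar F ℂ}
    (hψ : ∀ x, ψ (x ^ p) = ψ x) : gaussSum (χ ^ p) ψ = gaussSum χ ψ := by
  have hbij : Function.Bijective fun x : F => x ^ p := bijective_frobenius F p
  refine Fintype.sum_bijective _ hbij _ _ fun x => ?_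
  simp only [hψ, map_pow]
  rw [MulChar.pow_apply' _ hp.out.ne_zero]

/-- The Gauss sum of the inverse Teichmüller character with the trace character has the smallest
possible valuation `ζ - 1`. -/
theorem valuation_le_gaussSum_teichmuller [CharP F p] [Algebra (ZMod p) F] [DecidableEq F]
    (hpV : V.valuation (p : ℂ) < 1)
    {ζ : ℂ} (hζ : IsPrimitiveRoot ζ p) (j : F →+* IsLocalRing.ResidueField V)
    {χ : MulChar F ℂ} (hχ : ∀ (u : Fˣ) (z : V), (z : ℂ) = χ u →
      IsLocalRing.residue V z = j ((u⁻¹ : Fˣ) : F)) :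
    V.valuation (ζ - 1) ≤ V.valuation (gaussSum χ (traceChar F hζ)) := by
  have hψ := traceChar_ne_one F hζ
  have hp0 := hp.out.pos
  have hπ1 : V.valuation (ζ - 1) < 1 := by
    rw [valuation_primitiveRoot_sub_one_pow V hζ] at hpV
    by_contra! h
    exact absurd hpV (not_lt.2 (one_le_pow₀ h))
  by_cases hχ1 : χ = 1
  · rw [hχ1, valuation_gaussSum_one V hψ]
    exact hπ1.le
  let ζV : V := ⟨ζ, mem_of_isIntegral V (primitiveRoot_isIntegral hp0 hζ.pow_eq_one)⟩
  have hζres : IsLocalRing.residue V ζV = 1 := by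
    rw [← sub_eq_zero, ← map_one (IsLocalRing.residue V), ← map_sub,
      IsLocalRing.residue_eq_zero_iff, ValuationSubring.valuation_lt_one_iff]
    exact hπ1
  let χV : Fˣ → V := fun u => ⟨χ u, mem_of_isIntegral V (mulChar_isIntegral χ u)⟩
  let n : Fˣ → ℕ := fun u => (Algebra.trace (ZMod p) F u).val
  let G : V := ∑ u : Fˣ, χV u * ∑ i ∈ Finset.range (n u), ζV ^ i
  have hG : gaussSum χ (traceChar F hζ) = (G : ℂ) * (ζ - 1) := by
    -- Since `χ` sums to zero, each `ζ ^ n u` may be replaced by `ζ ^ n u - 1`, which is divisible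
    -- by `ζ - 1`.
    have h0 : ∑ u : Fˣ, χ u = 0 := by
      have h1 := MulChar.sum_eq_zero_of_ne_one hχ1
      rw [← h1]
      refine Fintype.sum_of_injective (fun a : Fˣ => (a : F)) Units.val_injective _ _ ?_
        fun _ => rfl
      intro i hi
      exact MulChar.map_nonunit _ fun h => hi ⟨h.unit, rfl⟩
    have h2 : gaussSum χ (traceChar F hζ) = ∑ u : Fˣ, χ u * (ζ ^ n u - 1) := by
      simp_rw [mul_sub, mul_one, Finset.sum_sub_distrib, h0, sub_zero]
      exact gaussSum_eq_sum_units _ _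
    have hGc : (G : ℂ) = ∑ u : Fˣ, χ u * ∑ i ∈ Finset.range (n u), ζ ^ i := by
      change V.subtype G = _
      simp only [G, map_sum, map_mul, map_pow]
      rfl
    rw [h2, hGc, Finset.sum_mul]
    refine Finset.sum_congr rfl fun u _ => ?_
    rw [mul_assoc, geom_sum_mul]
  -- Modulo the maximal ideal `G` is `∑ u⁻¹ Tr(u)`; in `Tr(u) = ∑ u ^ p ^ i` only `i = 0`
  -- contributes, giving `-1`. Hence `G` is a unit.
  have hGres : IsLocalRing.residue V G = -1 := by
    have h1 : IsLocalRing.residue V G = j (∑ u : Fˣ, ((u⁻¹ : Fˣ) : F) *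
        algebraMap (ZMod p) F (Algebra.trace (ZMod p) F u)) := by
      simp only [G, map_sum, map_mul, map_pow, hζres, one_pow, Finset.sum_const,
        Finset.card_range, nsmul_eq_mul, mul_one]
      refine Finset.sum_congr rfl fun u _ => ?_
      rw [hχ u (χV u) rfl]
      congr 1
      rw [← map_natCast j]
      congr 1
      rw [← map_natCast (algebraMap (ZMod p) F), ZMod.natCast_zmod_val]
    have h2 : ∑ u : Fˣ, ((u⁻¹ : Fˣ) : F) *
        algebraMap (ZMod p) F (Algebra.trace (ZMod p) F u) = -1 := by
      have hcard : Fintype.card F = p ^ Module.finrank (ZMod p) F := by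
        rw [Module.card_eq_pow_finrank (K := ZMod p) (V := F), ZMod.card]
      have hf : 0 < Module.finrank (ZMod p) F := Module.finrank_pos
      simp_rw [FiniteField.algebraMap_trace_eq_sum_pow, Nat.card_zmod, Finset.mul_sum]
      rw [Finset.sum_comm]
      have h3 : ∀ i ∈ Finset.range (Module.finrank (ZMod p) F),
          ∑ u : Fˣ, ((u⁻¹ : Fˣ) : F) * (u : F) ^ p ^ i = if i = 0 then -1 else 0 := by
        intro i hi
        have h4 : ∀ u : Fˣ, ((u⁻¹ : Fˣ) : F) * (u : F) ^ p ^ i = (u : F) ^ (p ^ i - 1) := by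
          intro u
          have : p ^ i = (p ^ i - 1) + 1 := (Nat.sub_add_cancel (Nat.one_le_pow _ _ hp0)).symm
          conv_lhs => rw [this, pow_succ', ← mul_assoc, Units.inv_mul, one_mul]
        rw [Finset.sum_congr rfl fun u _ => h4 u, FiniteField.sum_pow_units]
        have h5 : p ^ i < Fintype.card F := by
          rw [hcard]
          exact Nat.pow_lt_pow_right hp.out.one_lt (Finset.mem_range.1 hi)
        refine if_congr ?_ rfl rfl
        constructor
        · intro hd
          have h6 : p ^ i - 1 = 0 := Nat.eq_zero_of_dvd_of_lt hd (by
            have := Nat.one_le_pow i p hp0; omega)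
          by_contra hi0
          have := Nat.one_lt_pow hi0 hp.out.one_lt
          omega
        · rintro rfl; simp
      rw [Finset.sum_congr rfl h3]
      simp [hf]
    rw [h1, h2, map_neg, map_one]
  have hGv : V.valuation (G : ℂ) = 1 := by
    refine (V.valuation_lt_one_or_eq_one G).resolve_left fun h => ?_
    rw [← ValuationSubring.valuation_lt_one_iff, ← IsLocalRing.residue_eq_zero_iff, hGres] at h
    exact one_ne_zero (neg_eq_zero.1 h)
  rw [hG, map_mul, hGv, one_mul]

/-- Induction on base-`p` digits: `k = k % p + p * (k / p)`, where Frobenius removes the factor `p`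
and the product inequality handles the last digit. -/
theorem le_valuation_gaussSum_pow [CharP F p] {w : V.ValueGroup} {χ : MulChar F ℂ}
    {ψ : AddChar F ℂ} (hψ1 : ψ ≠ 1) (hψ : ∀ x, ψ (x ^ p) = ψ x)
    (hw : w ≤ V.valuation (gaussSum χ ψ)) (k : ℕ) :
    w ^ (p.digits k).sum ≤ V.valuation (gaussSum (χ ^ k) ψ) := by
  have hpow : ∀ d : ℕ, w ^ d ≤ V.valuation (gaussSum (χ ^ d) ψ) := by
    intro d
    induction d with
    | zero => rw [pow_zero, pow_zero, valuation_gaussSum_one V hψ1]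
    | succ d ih =>
      rw [pow_succ, pow_succ]
      exact (mul_le_mul' ih hw).trans (valuation_gaussSum_mul_le V _ _ hψ1)
  induction k using Nat.strong_induction_on with
  | _ k ih =>
  rcases Nat.eq_zero_or_pos k with rfl | hk
  · simp [valuation_gaussSum_one V hψ1]
  · have h1 := ih (k / p) (Nat.div_lt_self hk hp.out.one_lt)
    rw [Nat.digits_def' hp.out.one_lt hk, List.sum_cons, pow_add]
    have h2 : χ ^ k = χ ^ (k % p) * (χ ^ (k / p)) ^ p := by
      rw [← pow_mul, ← pow_add, mul_comm, Nat.mod_add_div]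
    rw [h2]
    refine le_trans ?_ (valuation_gaussSum_mul_le V _ _ hψ1)
    rw [gaussSum_pow_prime _ hψ]
    exact mul_le_mul' (hpow _) h1

theorem sum_digits_add_sum_digits {p f k : ℕ} (hp : p.Prime) (hf : 0 < f) (hk0 : 0 < k)
    (hk : k < p ^ f - 1) :
    (p.digits k).sum + (p.digits (p ^ f - 1 - k)).sum = (p - 1) * f := by
  have hN : 0 < p ^ f - 1 := by omega
  have hNR : ((p ^ f - 1 : ℕ) : ℝ) ≠ 0 := by exact_mod_cast hN.ne'
  have h : (((p.digits k).sum + (p.digits (p ^ f - 1 - k)).sum : ℕ) : ℝ) =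
      (((p - 1) * f : ℕ) : ℝ) := by
    rw [Nat.cast_add, Nat.cast_mul, Nat.cast_sub hp.one_lt.le, Nat.cast_one]
    rw [← sum_fract_eq_sum_digits hp.one_lt hf hk,
      ← sum_fract_eq_sum_digits hp.one_lt hf (by omega : p ^ f - 1 - k < p ^ f - 1), ← mul_add,
      ← Finset.sum_add_distrib]
    congr 1
    have : ∀ l ∈ Finset.range f, Int.fract (((p ^ l * k : ℕ) : ℝ) / ((p ^ f - 1 : ℕ) : ℝ)) +
        Int.fract (((p ^ l * (p ^ f - 1 - k) : ℕ) : ℝ) / ((p ^ f - 1 : ℕ) : ℝ)) = 1 := by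
      intro l _
      have e : ((p ^ l * (p ^ f - 1 - k) : ℕ) : ℝ) / ((p ^ f - 1 : ℕ) : ℝ) =
          -(((p ^ l * k : ℕ) : ℝ) / ((p ^ f - 1 : ℕ) : ℝ)) + ((p ^ l : ℕ) : ℝ) := by
        rw [Nat.cast_mul, Nat.cast_mul, Nat.cast_sub hk.le]
        field_simp
        ring
      have hne : Int.fract (((p ^ l * k : ℕ) : ℝ) / ((p ^ f - 1 : ℕ) : ℝ)) ≠ 0 := by
        rw [Ne, Int.fract_eq_zero_iff]
        rintro ⟨z, hz⟩
        rw [eq_div_iff hNR] at hz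
        have hz' : z * ((p ^ f - 1 : ℕ) : ℤ) = ((p ^ l * k : ℕ) : ℤ) := by exact_mod_cast hz
        have hd : p ^ f - 1 ∣ p ^ l * k := by
          rw [← Int.natCast_dvd_natCast]; exact ⟨z, by rw [← hz', mul_comm]⟩
        have hcop : Nat.Coprime (p ^ f - 1) (p ^ l) := by
          apply Nat.Coprime.pow_right
          rw [Nat.coprime_comm, hp.coprime_iff_not_dvd]
          intro hdp
          have h1 : p ∣ p ^ f := dvd_pow_self p hf.ne'
          have h2 : p ∣ p ^ f - (p ^ f - 1) := Nat.dvd_sub h1 hdp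
          rw [Nat.sub_sub_self (by omega)] at h2
          exact hp.one_lt.ne' (Nat.dvd_one.1 h2)
        exact absurd (Nat.le_of_dvd hk0 (hcop.dvd_of_dvd_mul_left hd)) (not_le.2 hk)
      rw [e, Int.fract_add_natCast, Int.fract_neg hne]
      ring
    rw [Finset.sum_congr rfl this]
    simp
  exact_mod_cast h

/-- Stickelberger's valuation of Gauss sums. -/
theorem valuation_gaussSum_pow_eq [CharP F p] {f : ℕ} (hcard : Fintype.card F = p ^ f)
    {w : V.ValueGroup} (hw0 : w ≠ 0) {χ : MulChar F ℂ}
    (hord : orderOf χ = Fintype.card F - 1) {ψ : AddChar F ℂ} (hψ1 : ψ ≠ 1)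
    (hψ : ∀ x, ψ (x ^ p) = ψ x) (hw : w ≤ V.valuation (gaussSum χ ψ))
    (hpw : V.valuation (p : ℂ) = w ^ (p - 1)) {k : ℕ} (hk : k < Fintype.card F - 1) :
    V.valuation (gaussSum (χ ^ k) ψ) = w ^ (p.digits k).sum := by
  have hf : 0 < f := by
    rcases Nat.eq_zero_or_pos f with rfl | h
    · have := Fintype.one_lt_card (α := F); simp [hcard] at this
    · exact h
  rcases Nat.eq_zero_or_pos k with rfl | hk0
  · simp [valuation_gaussSum_one V hψ1]
  have h1 := le_valuation_gaussSum_pow hψ1 hψ hw k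
  have h2 := le_valuation_gaussSum_pow hψ1 hψ hw (Fintype.card F - 1 - k)
  refine le_antisymm ?_ h1
  have hχk : χ ^ k ≠ 1 := fun h =>
    absurd (Nat.le_of_dvd hk0 (orderOf_dvd_of_pow_eq_one h)) (not_le.2 (hord ▸ hk))
  have hinv : χ ^ (Fintype.card F - 1 - k) = (χ ^ k)⁻¹ := by
    rw [eq_inv_iff_mul_eq_one, ← pow_add, Nat.sub_add_cancel hk.le]
    ext u
    rw [MulChar.pow_apply_coe, mulChar_unit_pow_eq_one, MulChar.one_apply_coe]
  -- The lower bounds for `k` and `q - 1 - k` multiply to the valuation of `q`, which is the exact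
  -- product of the two valuations; so both are equalities.
  have h3 := valuation_gaussSum_mul_inv V hχk hψ1
  rw [← hinv, hcard, Nat.cast_pow, map_pow, hpw, ← pow_mul,
    ← sum_digits_add_sum_digits hp.out hf hk0 (hcard ▸ hk), pow_add, ← hcard] at h3
  have hpos : 0 < w ^ (p.digits (Fintype.card F - 1 - k)).sum :=
    zero_lt_iff.2 (pow_ne_zero _ hw0)
  refine le_of_mul_le_mul_right ?_ hpos
  rw [← h3]
  exact mul_le_mul_right h2 _

/-- Passing from the Teichmüller character to `ω` introduces the exponent `c`; replacing the trace
character by its shift `ψ` only multiplies Gauss sums by roots of unity. -/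
theorem exists_valuation_gaussSum [CharP F p] [DecidableEq F] {f : ℕ}
    (hcard : Fintype.card F = p ^ f) {ψ : AddChar F ℂ} (hψ : ψ ≠ 1) {ω : MulChar F ℂ}
    (hω : ∀ χ : MulChar F ℂ, χ ∈ Subgroup.zpowers ω) :
    ∃ (V : ValuationSubring ℂ) (w : V.ValueGroup) (c : ℤ),
      IsCoprime c ((Fintype.card F : ℤ) - 1) ∧ V.valuation (p : ℂ) < 1 ∧
      V.valuation (p : ℂ) = w ^ (p - 1) ∧ ∀ k : ℤ, ∃ n : ℕ,
        V.valuation (gaussSum (ω ^ k) ψ) = w ^ n ∧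
        (n : ℝ) = ((p : ℝ) - 1) * ∑ l ∈ Finset.range f,
          Int.fract (k * ((c : ℝ) * p ^ l / ((Fintype.card F : ℝ) - 1))) := by
  let _ : Algebra (ZMod p) F := ZMod.algebra F p
  have hq : 1 < Fintype.card F := Fintype.one_lt_card
  have hf : 0 < f := by
    rcases Nat.eq_zero_or_pos f with rfl | h
    · simp [hcard] at hq
    · exact h
  obtain ⟨V, hV⟩ := exists_valuationSubring hp.out
  obtain ⟨ζ, hζ⟩ : ∃ ζ : ℂ, IsPrimitiveRoot ζ p := ⟨_, Complex.isPrimitiveRoot_exp p hp.out.ne_zero⟩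
  obtain ⟨j, χ, c, hc, rfl, hord, hχ⟩ := exists_teichmuller hV hω
  have hψ₀ := traceChar_ne_one F hζ
  obtain ⟨a, rfl⟩ := exists_eq_mulShift hψ hψ₀
  have hw := valuation_le_gaussSum_teichmuller hV hζ j hχ
  have hw0 : V.valuation (ζ - 1) ≠ 0 := by
    rw [Valuation.ne_zero_iff, sub_ne_zero]
    exact hζ.ne_one hp.out.one_lt
  refine ⟨V, V.valuation (ζ - 1), c, hc, hV, valuation_primitiveRoot_sub_one_pow V hζ,
    fun k => ?_⟩
  have hNZ : (0 : ℤ) < (Fintype.card F : ℤ) - 1 := by omega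
  obtain ⟨m, hm⟩ := Int.eq_ofNat_of_zero_le (Int.emod_nonneg (c * k) hNZ.ne')
  have hmlt := Int.emod_lt_of_pos (c * k) hNZ
  rw [hm] at hmlt
  have hmlt' : m < Fintype.card F - 1 := by omega
  refine ⟨(p.digits m).sum, ?_, ?_⟩
  · rw [valuation_gaussSum_mulShift, ← zpow_mul,
      ← valuation_gaussSum_pow_eq hcard hw0 hord hψ₀ (traceChar_pow F hζ) hw
        (valuation_primitiveRoot_sub_one_pow V hζ) hmlt']
    rw [← zpow_natCast χ m, ← hm, ← zpow_mod_orderOf, hord,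
      Nat.cast_sub hq.le, Nat.cast_one]
  · rw [← sum_fract_eq_sum_digits hp.out.one_lt hf (hcard ▸ hmlt'), ← hcard]
    congr 1
    refine Finset.sum_congr rfl fun l _ => ?_
    have hNR : (Fintype.card F : ℝ) - 1 ≠ 0 := by
      have : (1 : ℝ) < Fintype.card F := by exact_mod_cast hq
      linarith
    have e : (k : ℝ) * ((c : ℝ) * p ^ l / ((Fintype.card F : ℝ) - 1)) =
        ((p ^ l * m : ℕ) : ℝ) / ((Fintype.card F - 1 : ℕ) : ℝ) +
          ((p ^ l * ((c * k) / ((Fintype.card F : ℤ) - 1)) : ℤ) : ℝ) := by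
      have h1 := congrArg (Int.cast : ℤ → ℝ)
        (Int.emod_add_mul_ediv (c * k) ((Fintype.card F : ℤ) - 1))
      rw [hm] at h1
      push_cast at h1
      push_cast [Nat.cast_sub hq.le]
      field_simp
      linear_combination (-(p : ℝ) ^ l) * h1
    rw [e, Int.fract_add_intCast]

end Stickelberger

/-! ### The function `Λ`: integrality, positivity and jumps. -/

section Landau

open Filter Topology

/-- The number of indices `i` for which `a i * x` is an integer. -/
def intCount {n : ℕ} (a : Fin n → ℕ) (x : ℝ) : ℕ :=
  (Finset.univ.filter fun i => Int.fract ((a i : ℝ) * x) = 0).card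

theorem ceil_eq_floor_add (x : ℝ) : ⌈x⌉ = ⌊x⌋ + 1 - if Int.fract x = 0 then 1 else 0 := by
  split_ifs with h
  · obtain ⟨z, rfl⟩ := Int.fract_eq_zero_iff.1 h
    simp
  · rw [sub_zero, Int.ceil_eq_iff]
    have h1 := Int.floor_le x
    have h2 : (⌊x⌋ : ℝ) ≠ x := fun h' => h (by rw [← h', Int.fract_intCast])
    push_cast
    exact ⟨by simpa using lt_of_le_of_ne h1 h2, (Int.lt_floor_add_one x).le⟩

theorem floor_ceil_of_mem {y : ℝ} {n : ℤ} (h1 : (n : ℝ) < y) (h2 : y < n + 1) :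
    ⌊y⌋ = n ∧ ⌈y⌉ = n + 1 ∧ ∀ z : ℤ, y ≠ z := by
  refine ⟨Int.floor_eq_iff.2 ⟨h1.le, h2⟩, Int.ceil_eq_iff.2 ⟨by simpa using h1,
    by push_cast; exact h2.le⟩, ?_⟩
  rintro z rfl
  have h3 : n < z := by exact_mod_cast h1
  have h4 : z < n + 1 := by exact_mod_cast h2
  omega

theorem eventually_right (c : ℕ) (hc : 0 < c) (x : ℝ) : ∀ᶠ y in 𝓝[>] x,
    ⌊(c : ℝ) * y⌋ = ⌊(c : ℝ) * x⌋ ∧ ⌈(c : ℝ) * y⌉ = ⌊(c : ℝ) * x⌋ + 1 ∧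
      ∀ z : ℤ, (c : ℝ) * y ≠ z := by
  have hc' : (0 : ℝ) < c := by exact_mod_cast hc
  have h : ∀ᶠ y in 𝓝[>] x, (c : ℝ) * y < ⌊(c : ℝ) * x⌋ + 1 :=
    ((continuous_const_mul (c : ℝ)).tendsto x).eventually_lt_const
      (Int.lt_floor_add_one _) |>.filter_mono nhdsWithin_le_nhds
  filter_upwards [h, self_mem_nhdsWithin] with y hy hxy
  exact floor_ceil_of_mem ((Int.floor_le _).trans_lt (mul_lt_mul_of_pos_left hxy hc')) hy

theorem eventually_left (c : ℕ) (hc : 0 < c) (x : ℝ) : ∀ᶠ y in 𝓝[<] x,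
    ⌊(c : ℝ) * y⌋ = ⌈(c : ℝ) * x⌉ - 1 ∧ ⌈(c : ℝ) * y⌉ = ⌈(c : ℝ) * x⌉ ∧
      ∀ z : ℤ, (c : ℝ) * y ≠ z := by
  have hc' : (0 : ℝ) < c := by exact_mod_cast hc
  have h : ∀ᶠ y in 𝓝[<] x, (⌈(c : ℝ) * x⌉ : ℝ) - 1 < (c : ℝ) * y :=
    ((continuous_const_mul (c : ℝ)).tendsto x).eventually_const_lt
      (by have := Int.ceil_lt_add_one ((c : ℝ) * x); linarith)
      |>.filter_mono nhdsWithin_le_nhds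
  filter_upwards [h, self_mem_nhdsWithin] with y hy hxy
  have h2 := floor_ceil_of_mem (y := (c : ℝ) * y) (n := ⌈(c : ℝ) * x⌉ - 1)
    (by push_cast; exact hy)
    (by push_cast; rw [sub_add_cancel]
        exact (mul_lt_mul_of_pos_left hxy hc').trans_le (Int.le_ceil _))
  rwa [sub_add_cancel] at h2

variable {r s : ℕ} {e : Fin r → ℕ} {f : Fin s → ℕ}

/-- The linear parts cancel because `∑ e_i = ∑ f_j`, leaving floors and ceilings. -/
theorem landau_eq_int (hsum : ∑ i, e i = ∑ j, f j) (x : ℝ) :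
    landau e f x = ((∑ j, ⌈(f j : ℝ) * x⌉ - ∑ i, ⌊(e i : ℝ) * x⌋ : ℤ) : ℝ) := by
  have h1 : ∀ j, Int.fract (-(f j : ℝ) * x) = -((f j : ℝ) * x) + ⌈(f j : ℝ) * x⌉ := by
    intro j
    rw [Int.fract, neg_mul, Int.floor_neg]
    push_cast
    ring
  have h2 : ∀ i, Int.fract ((e i : ℝ) * x) = (e i : ℝ) * x - ⌊(e i : ℝ) * x⌋ := fun i => rfl
  have h3 : ∑ i, (e i : ℝ) * x = ∑ j, (f j : ℝ) * x := by
    rw [← Finset.sum_mul, ← Finset.sum_mul]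
    congr 1
    exact_mod_cast hsum
  simp only [landau, h1, h2, Finset.sum_sub_distrib, Finset.sum_add_distrib,
    Finset.sum_neg_distrib]
  push_cast
  linarith

theorem landau_nonneg (x : ℝ) : 0 ≤ landau e f x :=
  add_nonneg (Finset.sum_nonneg fun _ _ => Int.fract_nonneg _)
    (Finset.sum_nonneg fun _ _ => Int.fract_nonneg _)

theorem landau_fract (x : ℝ) : landau e f (Int.fract x) = landau e f x := by
  unfold landau
  congr 1 <;> refine Finset.sum_congr rfl fun i _ => ?_
  · rw [Int.fract_eq_fract]
    exact ⟨-(e i * ⌊x⌋), by rw [Int.fract]; push_cast; ring⟩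
  · rw [Int.fract_eq_fract]
    exact ⟨f i * ⌊x⌋, by rw [Int.fract]; push_cast; ring⟩

/-- The integers `n` with `n * x ∈ ℤ` form a subgroup `aℤ`, and `a` divides all exponents. -/
theorem isInt_of_forall_isInt (hgcd : Nat.gcd (Finset.univ.gcd e) (Finset.univ.gcd f) = 1)
    {x : ℝ} (he : ∀ i, ∃ n : ℤ, (e i : ℝ) * x = n) (hf : ∀ j, ∃ n : ℤ, (f j : ℝ) * x = n) :
    ∃ n : ℤ, x = n := by
  let H : AddSubgroup ℤ := (AddSubgroup.zmultiples (1 : ℝ)).comap (zmultiplesHom ℝ x)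
  have hmem : ∀ n : ℤ, n ∈ H ↔ ∃ m : ℤ, (n : ℝ) * x = m := by
    intro n
    simp only [H, AddSubgroup.mem_comap, AddSubgroup.mem_zmultiples_iff, zmultiplesHom_apply,
      zsmul_eq_mul, mul_one]
    exact exists_congr fun m => eq_comm
  obtain ⟨a, ha⟩ := Int.subgroup_cyclic H
  rw [← AddSubgroup.zmultiples_eq_closure] at ha
  have hdvd : ∀ n : ℕ, (∃ m : ℤ, (n : ℝ) * x = m) → a.natAbs ∣ n := by
    intro n hn
    have : (n : ℤ) ∈ H := (hmem n).2 (by simpa using hn)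
    rw [ha, Int.mem_zmultiples_iff] at this
    exact Int.natAbs_dvd_natAbs.2 this
  have h1 : a.natAbs ∣ 1 := by
    rw [← hgcd]
    exact Nat.dvd_gcd (Finset.dvd_gcd fun i _ => hdvd _ (he i))
      (Finset.dvd_gcd fun j _ => hdvd _ (hf j))
  have h2 : (1 : ℤ) ∈ H := by
    rw [ha, Int.mem_zmultiples_iff]
    exact Int.natAbs_dvd_natAbs.1 h1
  simpa using (hmem 1).1 h2

theorem landau_pos (hgcd : Nat.gcd (Finset.univ.gcd e) (Finset.univ.gcd f) = 1)
    {x : ℝ} (hx : x ∈ Set.Ioo (0 : ℝ) 1) : 0 < landau e f x := by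
  refine lt_of_le_of_ne (landau_nonneg x) fun h => ?_
  have h' := h.symm
  rw [landau, add_eq_zero_iff_of_nonneg (Finset.sum_nonneg fun _ _ => Int.fract_nonneg _)
    (Finset.sum_nonneg fun _ _ => Int.fract_nonneg _),
    Finset.sum_eq_zero_iff_of_nonneg fun _ _ => Int.fract_nonneg _,
    Finset.sum_eq_zero_iff_of_nonneg fun _ _ => Int.fract_nonneg _] at h'
  obtain ⟨n, rfl⟩ := isInt_of_forall_isInt hgcd
    (fun i => by
      obtain ⟨z, hz⟩ := Int.fract_eq_zero_iff.1 (h'.1 i (Finset.mem_univ i))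
      exact ⟨z, hz.symm⟩)
    (fun j => by
      obtain ⟨z, hz⟩ := Int.fract_eq_zero_iff.1 (h'.2 j (Finset.mem_univ j))
      exact ⟨-z, by push_cast; rw [hz]; ring⟩)
  have h1 : (0 : ℤ) < n := by exact_mod_cast hx.1
  have h2 : n < (1 : ℤ) := by exact_mod_cast hx.2
  omega

theorem genericPoints_subset (hgcd : Nat.gcd (Finset.univ.gcd e) (Finset.univ.gcd f) = 1) :
    genericPoints e f ⊆ Set.Ioo (0 : ℝ) 1 := by
  rintro x ⟨hx, he, hf⟩
  have hne : ∀ z : ℤ, x ≠ z := by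
    rintro z rfl
    rcases Nat.eq_zero_or_pos r with rfl | hr
    · rcases Nat.eq_zero_or_pos s with rfl | hs
      · simp at hgcd
      · exact hf ⟨0, hs⟩ (f ⟨0, hs⟩ * z) (by push_cast; ring)
    · exact he ⟨0, hr⟩ (e ⟨0, hr⟩ * z) (by push_cast; ring)
  exact ⟨lt_of_le_of_ne hx.1 fun h => hne 0 (by simp [← h]),
    lt_of_le_of_ne hx.2 fun h => hne 1 (by simp [h])⟩

/-- Near every point there is a generic point at which the Landau function exceeds its value at
the given point by the smaller one of its two jumps. -/
theorem exists_generic_landau (hsum : ∑ i, e i = ∑ j, f j) (he : ∀ i, 0 < e i)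
    (hf : ∀ j, 0 < f j) (x : ℝ) :
    ∃ y ∈ genericPoints e f, landau e f y = landau e f x + min (intCount e x) (intCount f x) := by
  suffices h : ∃ y : ℝ, ((∀ i, ∀ n : ℤ, (e i : ℝ) * y ≠ n) ∧ ∀ j, ∀ n : ℤ, (f j : ℝ) * y ≠ n) ∧
      landau e f y = landau e f x + min (intCount e x) (intCount f x) by
    obtain ⟨y, ⟨h1, h2⟩, h3⟩ := h
    refine ⟨Int.fract y, ⟨⟨Int.fract_nonneg y, (Int.fract_lt_one y).le⟩, fun i n hn => ?_,
      fun j n hn => ?_⟩, by rw [landau_fract, h3]⟩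
    · refine h1 i (n + e i * ⌊y⌋) ?_
      push_cast
      rw [← hn, Int.fract]; ring
    · refine h2 j (n + f j * ⌊y⌋) ?_
      push_cast
      rw [← hn, Int.fract]; ring
  have hcount : ∀ {n : ℕ} (a : Fin n → ℕ), (intCount a x : ℝ) =
      ((∑ i, if Int.fract ((a i : ℝ) * x) = 0 then 1 else 0 : ℤ) : ℝ) := by
    intro n a
    rw [Finset.sum_boole]
    simp [intCount]
  -- To the left the floors of the `e_i x` drop by `intCount e x` in total; to the right the
  -- ceilings of the `f_j x` rise by `intCount f x`. Go to the side with the smaller jump.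
  rcases le_total (intCount e x) (intCount f x) with h | h
  · rw [min_eq_left h]
    obtain ⟨y, hy1, hy2⟩ := ((eventually_all.2 fun i => eventually_left (e i) (he i) x).and
      (eventually_all.2 fun j => eventually_left (f j) (hf j) x)).exists
    refine ⟨y, ⟨fun i => (hy1 i).2.2, fun j => (hy2 j).2.2⟩, ?_⟩
    rw [landau_eq_int hsum, landau_eq_int hsum, hcount, ← Int.cast_add, Int.cast_inj,
      Finset.sum_congr rfl fun i _ => (hy1 i).1, Finset.sum_congr rfl fun j _ => (hy2 j).2.1,
      Finset.sum_congr (g := fun i => ⌊(e i : ℝ) * x⌋ -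
        if Int.fract ((e i : ℝ) * x) = 0 then 1 else 0) rfl
        fun i _ => by rw [ceil_eq_floor_add]; ring, Finset.sum_sub_distrib]
    ring
  · rw [min_eq_right h]
    obtain ⟨y, hy1, hy2⟩ := ((eventually_all.2 fun i => eventually_right (e i) (he i) x).and
      (eventually_all.2 fun j => eventually_right (f j) (hf j) x)).exists
    refine ⟨y, ⟨fun i => (hy1 i).2.2, fun j => (hy2 j).2.2⟩, ?_⟩
    rw [landau_eq_int hsum, landau_eq_int hsum, hcount, ← Int.cast_add, Int.cast_inj,
      Finset.sum_congr rfl fun i _ => (hy1 i).1, Finset.sum_congr rfl fun j _ => (hy2 j).2.1,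
      Finset.sum_congr (g := fun j => ⌈(f j : ℝ) * x⌉ +
        if Int.fract ((f j : ℝ) * x) = 0 then 1 else 0) rfl
        fun j _ => by rw [ceil_eq_floor_add]; ring, Finset.sum_add_distrib]
    ring

theorem exists_isLeast_landau (hsum : ∑ i, e i = ∑ j, f j)
    (hgcd : Nat.gcd (Finset.univ.gcd e) (Finset.univ.gcd f) = 1) {S : Set ℝ}
    (hS : S ⊆ Set.Ioo (0 : ℝ) 1) (hne : S.Nonempty) :
    ∃ l : ℤ, IsLeast (landau e f '' S) (l : ℝ) ∧ 1 ≤ l := by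
  have hpos : ∀ x ∈ S, ∀ z : ℤ, landau e f x = z → 1 ≤ z := by
    intro x hx z hz
    have := landau_pos hgcd (hS hx)
    rw [hz] at this
    have h0 : 0 < z := by exact_mod_cast this
    omega
  obtain ⟨l, ⟨x, hx, hl⟩, hmin⟩ := Int.exists_least_of_bdd
    (P := fun z => ∃ x ∈ S, landau e f x = z)
    ⟨1, fun z ⟨x, hx, hz⟩ => hpos x hx z hz⟩
    (by obtain ⟨x, hx⟩ := hne; exact ⟨_, x, hx, landau_eq_int hsum x⟩)
  refine ⟨l, ⟨⟨x, hx, hl⟩, ?_⟩, hpos x hx l hl⟩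
  rintro _ ⟨y, hy, rfl⟩
  rw [landau_eq_int hsum]
  exact_mod_cast hmin _ ⟨y, hy, landau_eq_int hsum y⟩

end Landau

/-! ### The multiplicities `s(m)`. -/

section ZeroMult

theorem expRoot_pow_eq_one_iff (x : ℚ) (n : ℕ) : expRoot x ^ n = 1 ↔ ∃ k : ℤ, (n : ℚ) * x = k := by
  rw [expRoot, ← Complex.exp_nat_mul, Complex.exp_eq_one_iff]
  refine exists_congr fun k => ?_
  have h : (2 * Real.pi * Complex.I : ℂ) ≠ 0 := Complex.two_pi_I_ne_zero
  have e1 : (n : ℂ) * (2 * Real.pi * Complex.I * (x : ℂ)) =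
      ((n * x : ℚ) : ℂ) * (2 * Real.pi * Complex.I) := by push_cast; ring
  rw [e1, mul_left_inj' h, ← Rat.cast_intCast, Rat.cast_inj]

theorem rootMultiplicity_X_pow_sub_one {n : ℕ} (hn : 0 < n) (z : ℂ) :
    (X ^ n - 1 : ℂ[X]).rootMultiplicity z = if z ^ n = 1 then 1 else 0 := by
  have hne : (X ^ n - 1 : ℂ[X]) ≠ 0 := by
    rw [← C_1]; exact X_pow_sub_C_ne_zero hn 1
  have hroot : (X ^ n - 1 : ℂ[X]).IsRoot z ↔ z ^ n = 1 := by
    rw [IsRoot.def]; simp [sub_eq_zero]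
  split_ifs with h
  · refine le_antisymm (rootMultiplicity_le_one_of_separable ?_ z)
      ((rootMultiplicity_pos hne).2 (hroot.2 h))
    rw [← C_1]
    exact separable_X_pow_sub_C 1 (by exact_mod_cast hn.ne') one_ne_zero
  · exact rootMultiplicity_eq_zero fun h' => h (hroot.1 h')

theorem prod_X_pow_sub_one_ne_zero {n : ℕ} {a : Fin n → ℕ} (ha : ∀ i, 0 < a i) :
    (∏ i, (X ^ a i - 1 : ℂ[X])) ≠ 0 :=
  Finset.prod_ne_zero_iff.2 fun i _ => by rw [← C_1]; exact X_pow_sub_C_ne_zero (ha i) 1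

theorem rootMultiplicity_prod_X_pow_sub_one {n : ℕ} {a : Fin n → ℕ} (ha : ∀ i, 0 < a i) (z : ℂ) :
    (∏ i, (X ^ a i - 1 : ℂ[X])).rootMultiplicity z =
      (Finset.univ.filter fun i => z ^ a i = 1).card := by
  rw [← count_roots, roots_prod _ _ (prod_X_pow_sub_one_ne_zero ha), Multiset.count_bind,
    Finset.card_filter]
  refine Finset.sum_congr rfl fun i _ => ?_
  rw [count_roots, rootMultiplicity_X_pow_sub_one (ha i)]

theorem rootMultiplicity_gcd {P Q : ℂ[X]} [DecidableEq ℂ[X]] (hP : P ≠ 0) (hQ : Q ≠ 0) (z : ℂ) :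
    (EuclideanDomain.gcd P Q).rootMultiplicity z =
      min (P.rootMultiplicity z) (Q.rootMultiplicity z) := by
  have h0 : EuclideanDomain.gcd P Q ≠ 0 := fun h => hP (EuclideanDomain.gcd_eq_zero_iff.1 h).1
  refine eq_of_forall_le_iff fun n => ?_
  rw [le_min_iff, le_rootMultiplicity_iff h0, le_rootMultiplicity_iff hP,
    le_rootMultiplicity_iff hQ]
  exact ⟨fun h => ⟨h.trans (EuclideanDomain.gcd_dvd_left _ _),
    h.trans (EuclideanDomain.gcd_dvd_right _ _)⟩, fun h => EuclideanDomain.dvd_gcd h.1 h.2⟩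

/-- The number of indices `i` for which `N` divides `a i * m`. -/
def dvdCount {n : ℕ} (a : Fin n → ℕ) (N m : ℕ) : ℕ :=
  (Finset.univ.filter fun i => N ∣ a i * m).card

theorem expRoot_div_pow_eq_one_iff {q : ℕ} (hq : 1 < q) (m n : ℕ) :
    expRoot ((m : ℚ) / ((q : ℚ) - 1)) ^ n = 1 ↔ q - 1 ∣ n * m := by
  have hN : ((q : ℚ) - 1) ≠ 0 := by
    have : (1 : ℚ) < q := by exact_mod_cast hq
    linarith
  rw [expRoot_pow_eq_one_iff, ← Int.natCast_dvd_natCast]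
  refine exists_congr fun k => ?_
  rw [← mul_div_assoc, div_eq_iff hN]
  push_cast [Nat.cast_sub hq.le]
  rw [mul_comm (k : ℚ)]
  constructor
  · intro h; exact_mod_cast h
  · intro h; exact_mod_cast h

variable {r s : ℕ} {e : Fin r → ℕ} {f : Fin s → ℕ}

theorem zeroMult_eq (he : ∀ i, 0 < e i) (hf : ∀ j, 0 < f j) {q : ℕ} (hq : 1 < q) (m : ℕ) :
    zeroMult e f q m = min (dvdCount e (q - 1) m) (dvdCount f (q - 1) m) := by
  classical
  rw [zeroMult, gcdPoly, rootMultiplicity_gcd (prod_X_pow_sub_one_ne_zero he)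
    (prod_X_pow_sub_one_ne_zero hf), rootMultiplicity_prod_X_pow_sub_one he,
    rootMultiplicity_prod_X_pow_sub_one hf]
  simp only [expRoot_div_pow_eq_one_iff hq, dvdCount]

theorem zeroMult_zero (he : ∀ i, 0 < e i) (hf : ∀ j, 0 < f j) {q : ℕ} (hq : 1 < q) :
    zeroMult e f q 0 = min r s := by
  simp [zeroMult_eq he hf hq, dvdCount]

/-- The reduction `% N` sends `gcd(0, N) = N` back to the index `0`, so the representative stays in
the range of summation. -/
theorem dvdCount_gcd {n : ℕ} (a : Fin n → ℕ) (N m : ℕ) :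
    dvdCount a N m = dvdCount a N (Nat.gcd m N % N) := by
  unfold dvdCount
  congr 1
  refine Finset.filter_congr fun i _ => ?_
  have h1 : N ∣ a i * (Nat.gcd m N % N) ↔ N ∣ a i * Nat.gcd m N :=
    ((Nat.mod_modEq (Nat.gcd m N) N).mul_left (a i)).dvd_iff dvd_rfl
  rw [h1, ← Nat.gcd_mul_left, Nat.dvd_gcd_iff]
  exact ⟨fun h => ⟨h, dvd_mul_left _ _⟩, fun h => h.1⟩

/-- Bounds the jumps of `Λ` at the points from Stickelberger's theorem by the counts that define
`s(m)`; `c` can be cancelled modulo `N`. -/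
theorem intCount_le_dvdCount {n : ℕ} (a : Fin n → ℕ) {N : ℕ} (hN : 0 < N) (m : ℕ) {c : ℤ}
    (hc : IsCoprime c N) : intCount a (m * (c / N)) ≤ dvdCount a N m := by
  refine Finset.card_le_card fun i => ?_
  simp only [Finset.mem_filter, Finset.mem_univ, true_and]
  intro h
  obtain ⟨z, hz⟩ := Int.fract_eq_zero_iff.1 h
  have hN' : (N : ℝ) ≠ 0 := by exact_mod_cast hN.ne'
  field_simp at hz
  have h1 : z * (N : ℤ) = a i * m * c := by exact_mod_cast hz
  rw [← Int.natCast_dvd_natCast]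
  refine hc.symm.dvd_of_dvd_mul_right ⟨z, ?_⟩
  push_cast
  rw [← h1, mul_comm]

theorem sum_eq_sum_of_isGammaVector {d : ℕ} {α β : Fin d → ℚ} (h : IsGammaVector α β e f) :
    ∑ i, e i = ∑ j, f j := by
  have hdeg : ∀ {n : ℕ} (a : Fin n → ℕ), (∀ i, 0 < a i) →
      (∏ i, (X ^ a i - 1 : ℂ[X])).natDegree = ∑ i, a i := by
    intro n a ha
    rw [natDegree_prod _ _ fun i _ => by rw [← C_1]; exact X_pow_sub_C_ne_zero (ha i) 1]
    refine Finset.sum_congr rfl fun i _ => ?_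
    rw [← C_1, natDegree_X_pow_sub_C]
  have hlin : ∀ γ : Fin d → ℚ, (∏ j, (X - C (expRoot (γ j)) : ℂ[X])).Monic := fun γ =>
    monic_prod_of_monic _ _ fun j _ => monic_X_sub_C _
  have hlindeg : ∀ γ : Fin d → ℚ, (∏ j, (X - C (expRoot (γ j)) : ℂ[X])).natDegree = d := by
    intro γ
    rw [natDegree_prod_of_monic _ _ fun j _ => monic_X_sub_C _]
    simp
  have h1 := congrArg natDegree h.cross_mul
  rw [(hlin α).natDegree_mul' (prod_X_pow_sub_one_ne_zero h.pos_right),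
    (hlin β).natDegree_mul' (prod_X_pow_sub_one_ne_zero h.pos_left), hlindeg, hlindeg,
    hdeg _ h.pos_left, hdeg _ h.pos_right] at h1
  omega

end ZeroMult

/-! ### Divisibility by `q ^ L` and conclusion. -/

section Main

variable {F : Type*} [Field F] [Fintype F] [DecidableEq F]

/-- The sum defining `H_q`, up to the normalising factors, is divisible by `q ^ L` whenever `L` is
a lower bound for the Landau function corrected by its jumps. -/
theorem pow_card_dvd_of_weighted_gaussSum {ψ : AddChar F ℂ} (hψ : ψ ≠ 1) {ω : MulChar F ℂ}
    (hω : ∀ χ : MulChar F ℂ, χ ∈ Subgroup.zpowers ω) {r s : ℕ} {e : Fin r → ℕ} {f : Fin s → ℕ}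
    {L : ℕ} (hL : ∀ x, (L : ℝ) ≤ landau e f x + min (intCount e x) (intCount f x))
    (u : Fˣ) {k : ℤ}
    (hk : ∑ m ∈ Finset.range (Fintype.card F - 1), (Fintype.card F : ℂ) ^
        (min (dvdCount e (Fintype.card F - 1) m) (dvdCount f (Fintype.card F - 1) m)) *
        ((∏ i, gaussSum (ω ^ (Sum.elim (fun i => (e i : ℤ)) (fun j => -(f j : ℤ)) i * m)) ψ) *
          (ω ^ m) u) = ((Fintype.card F : ℂ) - 1) * k) :
    (Fintype.card F : ℤ) ^ L ∣ k := by
  obtain ⟨p, hchar, ⟨n, hn⟩, hp, hcard⟩ := FiniteField.card' F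
  simp only [PNat.mk_coe] at hcard
  have : Fact p.Prime := ⟨hp⟩
  have hq : 1 < Fintype.card F := Fintype.one_lt_card
  have hN : 0 < Fintype.card F - 1 := by omega
  obtain ⟨V, w, c, hc, hpV, hpw, hg⟩ := exists_valuation_gaussSum hcard hψ hω
  choose b hb hb' using hg
  have hw1 : w ≤ 1 := by
    by_contra! h
    rw [hpw] at hpV
    exact absurd hpV (not_lt.2 (one_le_pow₀ h.le))
  have hqw : V.valuation (Fintype.card F : ℂ) = w ^ ((p - 1) * n) := by
    rw [hcard, Nat.cast_pow, map_pow, hpw, ← pow_mul]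
  have hkv : V.valuation (k : ℂ) ≤ V.valuation (p : ℂ) ^ (n * L) := by
    have h1 : V.valuation ((Fintype.card F : ℂ) - 1) = 1 := by
      have := valuation_int_of_isCoprime hpV (n := (Fintype.card F : ℤ) - 1) (by
        refine ⟨-1, (p : ℤ) ^ (n - 1), ?_⟩
        rw [← pow_succ, Nat.sub_add_cancel hn, hcard]
        push_cast
        ring)
      simpa using this
    rw [← one_mul (V.valuation (k : ℂ)), ← h1, ← map_mul, ← hk, hpw, ← pow_mul]
    refine Valuation.map_sum_le _ fun m _ => ?_
    rw [map_mul, map_mul, map_pow, hqw, map_prod, MulChar.pow_apply_coe, map_pow,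
      valuation_mulChar_unit, one_pow, mul_one]
    simp_rw [hb]
    rw [Finset.prod_pow_eq_pow_sum, ← pow_mul, ← pow_add]
    refine pow_le_pow_right_of_le_one' hw1 ?_
    rw [Fintype.sum_sum_type]
    simp only [Sum.elim_inl, Sum.elim_inr]
    set σ := min (dvdCount e (Fintype.card F - 1) m) (dvdCount f (Fintype.card F - 1) m)
    have hp1 : (0 : ℝ) ≤ (p : ℝ) - 1 := by
      have : (1 : ℝ) ≤ p := by exact_mod_cast hp.one_lt.le
      linarith
    let x : ℕ → ℝ := fun l => m * (((c * p ^ l : ℤ) : ℝ) / ((Fintype.card F - 1 : ℕ) : ℝ))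
    have hx : ∀ l (a : ℤ), Int.fract (((a * m : ℤ) : ℝ) *
        ((c : ℝ) * p ^ l / ((Fintype.card F : ℝ) - 1))) = Int.fract ((a : ℝ) * x l) := by
      intro l a
      congr 1
      simp only [x]
      push_cast [Nat.cast_sub hq.le]
      ring
    have hcop : ∀ l, IsCoprime (c * p ^ l : ℤ) ((Fintype.card F - 1 : ℕ) : ℤ) := by
      intro l
      rw [Nat.cast_sub hq.le, Nat.cast_one]
      refine IsCoprime.mul_left hc (IsCoprime.pow_left ⟨(p : ℤ) ^ (n - 1), -1, ?_⟩)
      rw [← pow_succ, Nat.sub_add_cancel hn, hcard]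
      push_cast
      ring
    have hlow : ∀ l, (L : ℝ) ≤ landau e f (x l) + σ := by
      intro l
      refine (hL (x l)).trans (add_le_add_right ?_ _)
      exact Nat.cast_le.2 (min_le_min (intCount_le_dvdCount e hN m (hcop l))
        (intCount_le_dvdCount f hN m (hcop l)))
    have hsum : ((∑ i, b ((e i : ℤ) * m) + ∑ j, b (-(f j : ℤ) * m) : ℕ) : ℝ) =
        ((p : ℝ) - 1) * ∑ l ∈ Finset.range n, landau e f (x l) := by
      push_cast
      simp_rw [hb', hx, landau]
      rw [Finset.sum_add_distrib, mul_add, ← Finset.mul_sum, ← Finset.mul_sum, Finset.sum_comm]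
      congr 2
      rw [Finset.sum_comm]
      simp
    have hreal : (((p - 1) * (n * L) : ℕ) : ℝ) ≤
        (((p - 1) * n * σ + (∑ i, b ((e i : ℤ) * m) + ∑ j, b (-(f j : ℤ) * m)) : ℕ) : ℝ) := by
      rw [Nat.cast_add, hsum]
      push_cast [Nat.cast_sub hp.one_lt.le]
      rw [mul_assoc, ← mul_add]
      refine mul_le_mul_of_nonneg_left ?_ hp1
      have := Finset.sum_le_sum fun l (_ : l ∈ Finset.range n) => hlow l
      rw [Finset.sum_add_distrib] at this
      simp only [Finset.sum_const, Finset.card_range, nsmul_eq_mul] at this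
      linarith
    exact_mod_cast hreal
  have := pow_dvd_of_valuation_le hpV hp hkv
  rw [hcard]
  push_cast
  rwa [← pow_mul]

theorem hypergeometricSum_integral {ψ : AddChar F ℂ} (hψ : ψ ≠ 1) {ω : MulChar F ℂ}
    (hω : ∀ χ : MulChar F ℂ, χ ∈ Subgroup.zpowers ω) {r s : ℕ} {e : Fin r → ℕ} {f : Fin s → ℕ}
    (he : ∀ i, 0 < e i) (hf : ∀ j, 0 < f j) (hsum : ∑ i, e i = ∑ j, f j) {L : ℕ}
    (hL : ∀ x, (L : ℝ) ≤ landau e f x + min (intCount e x) (intCount f x)) (t : F) :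
    ∃ n : ℤ, (Fintype.card F : ℂ) ^ ((min r s : ℕ) - L : ℤ) * hypergeometricSum ψ ω e f t = n := by
  have hq : 1 < Fintype.card F := Fintype.one_lt_card
  rw [hypergeometricSum]
  -- Only whether the argument vanishes matters; at `0` every `ω ^ m`, including the trivial one, is
  -- zero.
  generalize (-1) ^ (∑ j, f j) * ((bigM e f : ℚ) : F)⁻¹ * t = u
  by_cases hu : u = 0
  · refine ⟨0, ?_⟩
    simp [hu, MulChar.map_zero]
  lift u to Fˣ using isUnit_iff_ne_zero.2 hu
  have hc : ∑ i, Sum.elim (fun i => (e i : ℤ)) (fun j => -(f j : ℤ)) i = 0 := by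
    rw [Fintype.sum_sum_type]
    simp only [Sum.elim_inl, Sum.elim_inr, Finset.sum_neg_distrib]
    rw [← sub_eq_add_neg, sub_eq_zero]
    exact_mod_cast hsum
  obtain ⟨k, hk⟩ := exists_int_weighted_gaussSum hψ ω _ hc
    (fun m => min (dvdCount e (Fintype.card F - 1) m) (dvdCount f (Fintype.card F - 1) m))
    (fun m _ => by simp only [← dvdCount_gcd]) u
  obtain ⟨k', rfl⟩ := pow_card_dvd_of_weighted_gaussSum hψ hω hL u hk
  have hq0 : (Fintype.card F : ℂ) ≠ 0 := by exact_mod_cast (by omega : Fintype.card F ≠ 0)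
  have hq1 : (1 - (Fintype.card F : ℂ)) ≠ 0 := by
    rw [sub_ne_zero]
    exact_mod_cast hq.ne
  have hS : ∑ m ∈ Finset.range (Fintype.card F - 1),
      (Fintype.card F : ℂ) ^
          (-(zeroMult e f (Fintype.card F) 0 : ℤ) + (zeroMult e f (Fintype.card F) m : ℤ)) *
        (∏ i, gaussSum (ω ^ ((e i : ℤ) * m)) ψ) *
        (∏ j, gaussSum (ω ^ (-(f j : ℤ) * m)) ψ) * (ω ^ m) u =
      (Fintype.card F : ℂ) ^ (-(min r s : ℕ) : ℤ) *
        (((Fintype.card F : ℂ) - 1) * ((Fintype.card F : ℤ) ^ L * k' : ℤ)) := by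
    rw [← hk, Finset.mul_sum]
    refine Finset.sum_congr rfl fun m _ => ?_
    rw [zeroMult_zero he hf hq, zeroMult_eq he hf hq, zpow_add₀ hq0, zpow_natCast,
      Fintype.prod_sum_type]
    simp only [Sum.elim_inl, Sum.elim_inr]
    ring
  rw [hS]
  refine ⟨-(-1) ^ (r + s) * k', ?_⟩
  rw [sub_eq_add_neg, zpow_add₀ hq0, zpow_neg, zpow_neg, zpow_natCast, zpow_natCast]
  push_cast
  field_simp
  ring

end Main

end

end FiniteHypergeometric

theorem theorem4p2 {F : Type*} [Field F] [Fintype F]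
    (ψ : AddChar F ℂ) (hψ : ψ ≠ 1)
    (ω : MulChar F ℂ) (hω : ∀ χ : MulChar F ℂ, χ ∈ Subgroup.zpowers ω)
    {d r s : ℕ} (α β : Fin d → ℚ)
    (hdisj : ∀ i j, ∀ n : ℤ, α i - β j ≠ n)
    (e : Fin r → ℕ) (f : Fin s → ℕ)
    (hef : FiniteHypergeometric.IsGammaVector α β e f)
    (hα : ∀ i, (Fintype.card F).Coprime (α i).den)
    (hβ : ∀ j, (Fintype.card F).Coprime (β j).den) :
    (∃ l : ℤ, IsLeast (FiniteHypergeometric.landau e f '' Set.Ioo (0 : ℝ) 1) (l : ℝ) ∧ 1 ≤ l ∧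
      ∀ t : F, ∃ n : ℤ, (Fintype.card F : ℂ) ^ ((min r s : ℕ) - l : ℤ) *
        FiniteHypergeometric.hypergeometricSum ψ ω e f t = n) ∧
    (∃ l : ℤ, IsLeast (FiniteHypergeometric.landau e f ''
        FiniteHypergeometric.genericPoints e f) (l : ℝ) ∧ 1 ≤ l ∧
      ∀ t : F, ∃ n : ℤ, (Fintype.card F : ℂ) ^ ((min r s : ℕ) - l : ℤ) *
        FiniteHypergeometric.hypergeometricSum ψ ω e f t = n) := by
  classical
  open FiniteHypergeometric in
  have hsum := sum_eq_sum_of_isGammaVector hef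
  have hsub := genericPoints_subset hef.gcd_eq_one
  have hjump := exists_generic_landau hsum hef.pos_left hef.pos_right
  have key : ∀ l : ℤ, 1 ≤ l → (∀ y ∈ genericPoints e f, (l : ℝ) ≤ landau e f y) →
      ∀ t : F, ∃ n : ℤ, (Fintype.card F : ℂ) ^ ((min r s : ℕ) - l : ℤ) *
        hypergeometricSum ψ ω e f t = n := by
    intro l hl hy
    lift l to ℕ using by omega
    refine hypergeometricSum_integral hψ hω hef.pos_left hef.pos_right hsum fun x => ?_
    obtain ⟨y, hyg, hyx⟩ := hjump x
    have := hy y hyg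
    rw [hyx] at this
    exact_mod_cast this
  -- Any base point would do; this supplies a generic point, so both sets are nonempty.
  obtain ⟨y, hy, -⟩ := hjump 0
  obtain ⟨l, hl, hl1⟩ := exists_isLeast_landau hsum hef.gcd_eq_one subset_rfl ⟨y, hsub hy⟩
  obtain ⟨l', hl', hl1'⟩ := exists_isLeast_landau hsum hef.gcd_eq_one hsub ⟨y, hy⟩
  exact ⟨⟨l, hl, hl1, key l hl1 fun z hz => hl.2 ⟨z, hsub hz, rfl⟩⟩,
    ⟨l', hl', hl1', key l' hl1' fun z hz => hl'.2 ⟨z, hz, rfl⟩⟩⟩
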